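/- Fix a universe $\mathcal U$; "small" means $\mathcal U$-small. All categories have small hom-sets and are equivalent to a category whose objects and arrows belong to $\mathcal U$. **Presites.** A sink on $X$ is a set of arrows with target $X$; it is *epi* if it is jointly epimorphic. An arrow is *pullbackable* if its pullback along every arrow exists. A *presite* $(\mathcal C,\tau)$ is a category with a pretopology: a class of sinks (coverings) consisting of pullbackable arrows, containing the isomorphisms, stable under base change and composition. An arrow is *clopen* if it belongs to some covering; it is required moreover that every sink of clopen arrows which has a refinement that is a covering is a covering. It is a *$\mathcal U$-presite* if for every object $X$ there is a small set $G_X$ of objects such that the source of any clopen arrow $U\to X$ has a covering by arrows with sources in $G_X$. A functor between presites is *continuous* if it preserves coverings and pullbacks of clopen arrows along arbitrary arrows. **Glutoses.** A *$\mathcal U$-glutos* is a pair $(\mathcal G,\mathcal O)$ where $\mathcal O$ is a class of pullbackable arrows (called open) of $\mathcal G$ containing the isomorphisms, stable under composition and base change, such that: (1) $fg\in\mathcal O$ and $f\in\mathcal O$ imply $g\in\mathcal O$; (2) for every $X$ the full subcategory $\mathcal O/X\subset\mathcal G/X$ on the arrows in $\mathcal O$ is a Grothendieck topos (relative to $\mathcal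 U$), and for every $f:X\to Y$ base change $f^*:\mathcal O/Y\to\mathcal O/X$ is the inverse image part of a geometric morphism; (3) $\mathcal G$ has small disjoint universal coproducts with open injections, and an arrow from a small coproduct is open if its components are; (4) open epimorphisms are effective; if $p$ is an open epimorphism and $fp$ is open then $f$ is open; every equivalence relation $d_0,d_1:U\rightrightarrows X$ with $d_0,d_1\in\mathcal O$ for which there is an epi sink $\{u_i:U_i\to X\}$ of open arrows such that each inverse image $u_i^*(d_0,d_1)$ is coequalized by some open arrow, is effective and has an open universal coequalizer; (5) if $r:X\to R$ is an open epimorphism and $g:R\to S$, $f:Y\to S$ are arrows such that the pullback of $f$ along $gr$ exists, then the pullback of $f$ along $g$ exists. A $\mathcal U$-glutos is regarded as a presite whose coverings are the epi sinks of open arrows. A *universal $\mathcal U$-glutos* of a $\mathcal U$-presite $\mathcal P$ is a $\mathcal U$-glutos $\widetilde{\mathcal P}$ with a continuous functor $Y:\mathcal P\to\widetilde{\mathcal P}$ such that for every $\mathcal U$-glutos $\mathcal D$ composition with $Y$ is an equivalence from the category of continuous functors $\widetilde{\mathcal P}\to\mathcal D$ (with all natural transformations) to that of continuous functors $\mathcal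 P\to\mathcal D$. **Nearly glutoses.** A $\mathcal U$-presite is a *nearly $\mathcal U$-glutos* if, for some $\mathcal U$-presite $\mathcal P$, it is equivalent as a presite (by an equivalence continuous in both directions) to $\widetilde{\mathcal P}$ equipped with those of its coverings that consist of monomorphisms. **Proposition.** Let $(\mathcal C,\tau)$ be a nearly $\mathcal U$-glutos and $X$ an object of $\mathcal C$. Let $\mathcal O(X)$ be the partially ordered set of clopen subobjects of $X$. Let $\mathcal{LO}$ be the class of locally clopen arrows, i.e. of arrows $f:Y\to Z$ such that for some covering $\{u_i\}$ of $Y$ all $fu_i$ are clopen, and $\mathcal{LO}/X$ the full subcategory of $\mathcal C/X$ on the arrows in $\mathcal{LO}$. For $u\in\mathcal O(X)$ let $su$ be a clopen arrow to $X$ representing $u$, viewed as an object of $\mathcal{LO}/X$. Then: (a) $\mathcal O(X)$ is small and is a complete Heyting algebra, and the category $\mathrm{Sh}\,X$ of sheaves of small sets on $\mathcal O(X)$ is an SG-topos, that is, a Grothendieck topos in which the subobjects of $1$ generate. (b) There is an equivalence of categories $J:\mathrm{Sh}\,X\to\mathcal{LO}/X$ with isomorphisms $\beta: F(u)\cong\mathrm{Hom}_{\mathcal{LO}/X}(su,JF)$,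 natural in $u\in\mathcal O(X)$ and in the sheaf $F$; that is, $F$ is the sheaf of sections of $JF$. (c) For every sheaf $F$, order the set $I_F=\coprod_{u\in\mathcal O(X)}F(u)$ by $\langle u,x\rangle\le\langle v,y\rangle$ iff $u\le v$ and $x=y|_u$. Then any two elements of $I_F$ have a meet, and $JF$ is obtained by gluing the copies of $su$ indexed by $\langle u,x\rangle\in I_F$ along these meets: the arrows $\beta(x):su\to JF$ exhibit $JF$ as the colimit in $\mathcal{LO}/X$ of the diagram consisting of the objects $su$ for $\langle u,x\rangle\in I_F$, the objects $sw$ for $\langle u,x\rangle\wedge\langle v,y\rangle=\langle w,z\rangle$, and the inclusions $su\leftarrow sw\to sv$. -/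

import Mathlib

open CategoryTheory Limits Opposite

universe w w' w'' v' v'' u

namespace Glutos

/-! ### Pretopologies and presites

A sink on `X` is a set of arrows with target `X`, that is, a `Presieve X`; a set of sinks is a
`Precoverage`. -/

section Presites

variable {C : Type w} [Category.{u} C]

/-- The clopen arrows of `τ`: those which belong to some covering. -/
def clopen (τ : Precoverage C) : MorphismProperty C :=
  fun _ X f => ∃ S ∈ τ X, S f

/-- `τ` is a pretopology: its coverings consist of pullbackable arrows, isomorphisms are coverings,
and coverings are stable under base change and under composition. Moreover `τ` is complete: a sink
of clopen arrows which has a refinement that is a covering is itself a covering. -/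
class IsPresite (τ : Precoverage C) : Prop extends
    τ.HasPullbacks, τ.HasIsos, τ.IsStableUnderBaseChange, τ.IsStableUnderComposition where
  mem_of_refinement : ∀ ⦃X : C⦄ (S R : Presieve X),
    (∀ ⦃Y : C⦄ ⦃f : Y ⟶ X⦄, S f → clopen τ f) → R ∈ τ X →
    (∀ ⦃Z : C⦄ ⦃g : Z ⟶ X⦄, R g → ∃ (Y : C) (f : Y ⟶ X) (h : Z ⟶ Y), S f ∧ h ≫ f = g) →
    S ∈ τ X

/-- Existence of local small sets of topological generators, smallness being relative to the
universe of the hom-sets of the category. -/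
def HasLocalGenerators (τ : Precoverage C) : Prop :=
  ∀ X : C, ∃ (ι : Type u) (G : ι → C), ∀ ⦃U : C⦄ (f : U ⟶ X), clopen τ f →
    ∃ S ∈ τ U, ∀ ⦃V : C⦄ ⦃g : V ⟶ U⦄, S g → V ∈ Set.range G

/-- Continuous functors: they respect coverings, and pullbacks of clopen arrows along arbitrary
arrows. -/
structure IsContinuous {D : Type w'} [Category.{v'} D] (τ : Precoverage C) (σ : Precoverage D)
    (F : C ⥤ D) : Prop where
  map_mem : ∀ ⦃X : C⦄ ⦃S : Presieve X⦄, S ∈ τ X → S.map F ∈ σ (F.obj X)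
  map_isPullback : ∀ ⦃P Z U X : C⦄ ⦃fst : P ⟶ Z⦄ ⦃snd : P ⟶ U⦄ ⦃g : Z ⟶ X⦄ ⦃f : U ⟶ X⦄,
    clopen τ f → IsPullback fst snd g f →
      IsPullback (F.map fst) (F.map snd) (F.map g) (F.map f)

theorem IsContinuous.map_clopen {D : Type w'} [Category.{v'} D] {τ : Precoverage C}
    {σ : Precoverage D} {F : C ⥤ D} (hF : IsContinuous τ σ F) {U X : C} {f : U ⟶ X}
    (hf : clopen τ f) : clopen σ (F.map f) := by
  obtain ⟨S, hS, hf⟩ := hf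
  exact ⟨_, hF.map_mem hS, ⟨hf⟩⟩

theorem IsContinuous.comp {D : Type w'} [Category.{v'} D] {E : Type w''} [Category.{v''} E]
    {τ : Precoverage C} {σ : Precoverage D} {ρ : Precoverage E} {F : C ⥤ D} {G : D ⥤ E}
    (hF : IsContinuous τ σ F)
    (hG : ∀ ⦃X : D⦄ ⦃S : Presieve X⦄, S ∈ σ X → S.map G ∈ ρ (G.obj X))
    (hG' : ∀ ⦃P Z U X : D⦄ ⦃fst : P ⟶ Z⦄ ⦃snd : P ⟶ U⦄ ⦃g : Z ⟶ X⦄ ⦃f : U ⟶ X⦄,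
      clopen σ f → IsPullback fst snd g f →
        IsPullback (G.map fst) (G.map snd) (G.map g) (G.map f)) :
    IsContinuous τ ρ (F ⋙ G) where
  map_mem X S hS := by
    have h := hG (hF.map_mem hS)
    have e : (S.map F).map G = S.map (F ⋙ G) := by
      refine le_antisymm ?_ ?_
      · rintro _ _ ⟨⟨h⟩⟩
        exact Presieve.map.of (F := F ⋙ G) h
      · rintro _ _ ⟨h⟩
        exact Presieve.map.of (F := G) (Presieve.map.of (F := F) h)
    rw [← e]
    exact h
  map_isPullback _ _ _ _ _ _ _ _ hf hp := hG' (hF.map_clopen hf) (hF.map_isPullback hf hp)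

/-- The pretopology of all coverings which consist of monomorphisms. -/
def monoPart (τ : Precoverage C) : Precoverage C where
  coverings X := {S | S ∈ τ X ∧ ∀ ⦃Y : C⦄ ⦃f : Y ⟶ X⦄, S f → Mono f}

/-- Locally clopen arrows: those which become clopen on some covering of their source. -/
def locallyClopen (τ : Precoverage C) : MorphismProperty C :=
  fun Y _ f => ∃ S ∈ τ Y, ∀ ⦃Z : C⦄ ⦃g : Z ⟶ Y⦄, S g → clopen τ (g ≫ f)

theorem locallyClopen_of_clopen (τ : Precoverage C) [IsPresite τ] {Y X : C} {f : Y ⟶ X}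
    (hf : clopen τ f) : locallyClopen τ f := by
  refine ⟨.singleton (𝟙 Y), Precoverage.HasIsos.mem_coverings_of_isIso (𝟙 Y), ?_⟩
  rintro _ _ ⟨⟩
  simpa using hf

end Presites

/-! ### Glutoses -/

section Glutos

variable {C : Type w} [Category.{u} C]

/-- A sink is epi when it is jointly epimorphic. -/
def IsEpiSink {X : C} (S : Presieve X) : Prop :=
  ∀ ⦃Z : C⦄ (a b : X ⟶ Z), (∀ ⦃Y : C⦄ ⦃f : Y ⟶ X⦄, S f → f ≫ a = f ≫ b) → a = b

/-- `d₀, d₁` is an equivalence relation on `X`: it identifies `Hom(T, U)`, for every `T`, with an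
equivalence relation on the set `Hom(T, X)`. -/
def IsEquivRel {U X : C} (d₀ d₁ : U ⟶ X) : Prop :=
  ∀ T : C, (∀ s t : T ⟶ U, s ≫ d₀ = t ≫ d₀ → s ≫ d₁ = t ≫ d₁ → s = t) ∧
    Equivalence (fun a b : T ⟶ X => ∃ t : T ⟶ U, t ≫ d₀ = a ∧ t ≫ d₁ = b)

/-- `d₀', d₁' : U' ⟶ X'` is the inverse image of `d₀, d₁ : U ⟶ X` along `f : X' ⟶ X`. -/
def IsInverseImage {U X U' X' : C} (d₀ d₁ : U ⟶ X) (f : X' ⟶ X) (d₀' d₁' : U' ⟶ X') : Prop :=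
  ∃ (U₀ U₁ : C) (a₀ : U₀ ⟶ X') (b₀ : U₀ ⟶ U) (b₁ : U₁ ⟶ U) (a₁ : U₁ ⟶ X')
    (c₀ : U' ⟶ U₀) (c₁ : U' ⟶ U₁),
    IsPullback a₀ b₀ f d₀ ∧ IsPullback b₁ a₁ d₁ f ∧ IsPullback c₀ c₁ b₀ b₁ ∧
      d₀' = c₀ ≫ a₀ ∧ d₁' = c₁ ≫ a₁

/-- `d₀, d₁` is `O`-coequalizable when some arrow of `O` coequalizes it. -/
def IsCoequalizable (O : MorphismProperty C) {U X : C} (d₀ d₁ : U ⟶ X) : Prop :=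
  ∃ (Q : C) (q : X ⟶ Q), O q ∧ d₀ ≫ q = d₁ ≫ q

/-- `d₀, d₁` is locally `O`-coequalizable: its inverse images along the members of some epi sink of
arrows of `O` are `O`-coequalizable. -/
def IsLocallyCoequalizable (O : MorphismProperty C) {U X : C} (d₀ d₁ : U ⟶ X) : Prop :=
  ∃ S : Presieve X, IsEpiSink S ∧ ∀ ⦃X' : C⦄ ⦃f : X' ⟶ X⦄, S f → O f ∧
    ∃ (U' : C) (d₀' d₁' : U' ⟶ X'), IsInverseImage d₀ d₁ f d₀' d₁' ∧ IsCoequalizable O d₀' d₁'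

/-- `E` is a Grothendieck topos relative to the universe `u`: it is equivalent to the category of
sheaves of sets on a small site. -/
def IsTopos (E : Type w') [Category.{v'} E] : Prop :=
  ∃ (D : Type u) (_ : SmallCategory D) (J : GrothendieckTopology D),
    Nonempty (E ≌ Sheaf J (Type u))

/-- `E` is an SG-topos: a Grothendieck topos in which the subobjects of the terminal object form a
generating class. -/
def IsSGTopos (E : Type w') [Category.{v'} E] : Prop :=
  IsTopos.{w', v', u} E ∧ ObjectProperty.IsSeparating (fun A : E => IsSubterminal A)

/-- A clopos structure: the arrows of `O` are pullbackable, and `O` contains all isomorphisms and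
is stable under composition and pullback. -/
class IsClopos (O : MorphismProperty C) : Prop extends
    O.IsMultiplicative, O.IsStableUnderBaseChange where
  hasPullback : ∀ ⦃U X Y : C⦄ (f : U ⟶ X) (g : Y ⟶ X), O f → HasPullback f g

instance (O : MorphismProperty C) [IsClopos O] {X Y : C} (f : X ⟶ Y) : O.HasPullbacksAlong f where
  hasPullback g hg := IsClopos.hasPullback g f hg

/-- `(C, O)` is a glutos relative to the universe `u` of the hom-sets of `C`. Small means small in
this universe, and `O.Over ⊤ X` is the full subcategory of the category of arrows over `X` formed
by the arrows in `O`. -/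
class IsGlutos (O : MorphismProperty C) : Prop extends IsClopos O where
  /-- If `f` and `g ≫ f` are open then so is `g`. -/
  of_postcomp : ∀ ⦃X Y Z : C⦄ (g : X ⟶ Y) (f : Y ⟶ Z), O f → O (g ≫ f) → O g
  /-- The category of open arrows over any object is a topos. -/
  isTopos : ∀ X : C, IsTopos.{max w u, u, u} (O.Over ⊤ X)
  /-- Base change is the inverse image part of a geometric morphism: it has a right adjoint. -/
  isLeftAdjoint : ∀ ⦃X Y : C⦄ (f : X ⟶ Y),
    (MorphismProperty.Over.pullback O ⊤ f).IsLeftAdjoint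
  /-- Base change is the inverse image part of a geometric morphism: it is left exact. -/
  preservesFiniteLimits : ∀ ⦃X Y : C⦄ (f : X ⟶ Y),
    PreservesFiniteLimits (MorphismProperty.Over.pullback O ⊤ f)
  /-- Small coproducts exist, are universal, and their injections are open. -/
  exists_coproduct : ∀ ⦃ι : Type u⦄ (X : ι → C),
    ∃ c : Cofan X, IsUniversalColimit c ∧ ∀ i, O (c.inj i)
  /-- Small coproducts are disjoint. -/
  coproductDisjoint : ∀ ⦃ι : Type u⦄ (X : ι → C), CoproductDisjoint X
  /-- An arrow from a small coproduct is open if its components are open. -/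
  of_coproduct : ∀ ⦃ι : Type u⦄ ⦃X : ι → C⦄ (c : Cofan X), IsColimit c →
    ∀ ⦃Y : C⦄ (f : c.pt ⟶ Y), (∀ i, O (c.inj i ≫ f)) → O f
  /-- Open epimorphisms are effective. -/
  effectiveEpi : ∀ ⦃X Y : C⦄ (f : X ⟶ Y), O f → Epi f → EffectiveEpi f
  /-- If `p` is an epimorphism, and `p` and `p ≫ f` are open, then `f` is open. -/
  of_precomp : ∀ ⦃X Y Z : C⦄ (p : X ⟶ Y) (f : Y ⟶ Z), Epi p → O p → O (p ≫ f) → O f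
  /-- An open, locally coequalizable equivalence relation has an open universal coequalizer, of
  which it is the kernel pair. -/
  exists_coequalizer : ∀ ⦃U X : C⦄ (d₀ d₁ : U ⟶ X), IsEquivRel d₀ d₁ → O d₀ → O d₁ →
    IsLocallyCoequalizable O d₀ d₁ → ∃ (Q : C) (q : X ⟶ Q) (hq : d₀ ≫ q = d₁ ≫ q),
      O q ∧ IsUniversalColimit (Cofork.ofπ q hq) ∧ IsKernelPair q d₀ d₁
  /-- Pullbacks may be constructed locally on the base. -/
  hasPullback_of_local : ∀ ⦃X R S Y : C⦄ (r : X ⟶ R) (g : R ⟶ S) (f : Y ⟶ S),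
    O r → Epi r → HasPullback f (r ≫ g) → HasPullback f g

/-- The canonical pretopology of a glutos: its coverings are the epi sinks of open arrows. -/
def openEpi (O : MorphismProperty C) : Precoverage C where
  coverings X := {S | (∀ ⦃Y : C⦄ ⦃f : Y ⟶ X⦄, S f → O f) ∧ IsEpiSink S}

end Glutos

/-! ### Universal glutoses and nearly glutoses -/

/-- The category of continuous functors and all natural transformations between them. -/
abbrev ContinuousFunctor {C : Type w} [Category.{u} C] {D : Type w'} [Category.{v'} D]
    (τ : Precoverage C) (σ : Precoverage D) :=
  ObjectProperty.FullSubcategory (fun F : C ⥤ D => IsContinuous τ σ F)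

/-- Precomposition with a continuous functor. -/
def precomp {C : Type w} [Category.{u} C] {D : Type w'} [Category.{v'} D] {E : Type w''}
    [Category.{v''} E] {τ : Precoverage C} {σ : Precoverage D} (ρ : Precoverage E) (F : C ⥤ D)
    (hF : IsContinuous τ σ F) : ContinuousFunctor σ ρ ⥤ ContinuousFunctor τ ρ :=
  ObjectProperty.lift _ (ObjectProperty.ι _ ⋙ (Functor.whiskeringLeft C D E).obj F)
    (fun G => hF.comp G.property.map_mem G.property.map_isPullback)

/-- `Y : (P, τ) ⟶ (G, O)` makes the glutos `(G, O)` the universal glutos for the presite `(P, τ)`: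
for every glutos `(D, O')`, composition with `Y` is an equivalence from the category of continuous
functors `G ⥤ D` to the category of continuous functors `P ⥤ D`. -/
structure IsUniversalGlutos {P : Type (u + 1)} [LargeCategory P] (τ : Precoverage P)
    {G : Type (u + 1)} [LargeCategory G] (O : MorphismProperty G) (Y : P ⥤ G) : Prop where
  isGlutos : IsGlutos O
  isContinuous : IsContinuous τ (openEpi O) Y
  isEquivalence : ∀ (D : Type (u + 1)) [LargeCategory D] (O' : MorphismProperty D), IsGlutos O' →
    (precomp (openEpi O') Y isContinuous).IsEquivalence

/-- The presite `(C, τ)` is a nearly glutos: it has local small sets of generators, and there are a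
presite `(P, σ)` with local small sets of generators and a universal glutos `(G, O)` for it such
that `(C, τ)` is equivalent, as a presite, to `G` with the coverings that consist of
monomorphisms. -/
def IsNearlyGlutos {C : Type w} [Category.{u} C] (τ : Precoverage C) [IsPresite τ] : Prop :=
  HasLocalGenerators τ ∧
    ∃ (P : Type (u + 1)) (_ : LargeCategory P) (σ : Precoverage P)
      (G : Type (u + 1)) (_ : LargeCategory G) (O : MorphismProperty G) (Y : P ⥤ G) (e : C ≌ G),
      IsPresite σ ∧ HasLocalGenerators σ ∧ IsUniversalGlutos σ O Y ∧
        IsContinuous τ (monoPart (openEpi O)) e.functor ∧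
        IsContinuous (monoPart (openEpi O)) τ e.inverse

/-! ### Complete Heyting algebras and their sheaves -/

/-- The partially ordered set `α` is a complete Heyting algebra. -/
def IsCompleteHeyting (α : Type w) [PartialOrder α] : Prop :=
  ∃ F : Order.Frame α, ∀ a b : α, F.le a b ↔ a ≤ b

/-- The canonical topology of a partially ordered set: `S` covers `u` when every `v ≤ u` is the
least upper bound of the elements of `S` below `v`. In a complete Heyting algebra this says that
`u` is the supremum of `S`, see `mem_canonicalTopology_iff`. -/
def canonicalTopology (α : Type w) [PartialOrder α] : GrothendieckTopology α where
  sieves u := {S | ∀ v ≤ u, IsLUB {x | x ≤ v ∧ ∃ h : x ⟶ u, S h} v}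
  top_mem' u v hv := ⟨fun x hx => hx.1, fun b hb => hb ⟨le_rfl, homOfLE hv, trivial⟩⟩
  pullback_stable' u u' S f hS v hv := by
    refine ⟨fun x hx => hx.1, fun b hb => (hS v (hv.trans (leOfHom f))).2 ?_⟩
    rintro x ⟨hx, h, hS⟩
    refine hb ⟨hx, homOfLE (hx.trans hv), ?_⟩
    have e : homOfLE (hx.trans hv) ≫ f = h := Subsingleton.elim _ _
    simpa [Sieve.pullback_apply, e] using hS
  transitive' u S hS R hR v hv := by
    refine ⟨fun x hx => hx.1, fun b hb => (hS v hv).2 ?_⟩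
    rintro x ⟨hx, h, hSh⟩
    refine (hR hSh x le_rfl).2 ?_
    rintro y ⟨hy, k, hk⟩
    exact hb ⟨hy.trans hx, k ≫ h, hk⟩

theorem mem_canonicalTopology_iff (α : Type w) [Order.Frame α] (u : α) (S : Sieve u) :
    S ∈ canonicalTopology α u ↔ sSup {x | ∃ h : x ⟶ u, S h} = u := by
  constructor
  · intro h
    have h' := (h u le_rfl).sSup_eq
    refine le_antisymm (sSup_le fun x hx => leOfHom hx.choose) ?_
    conv_lhs => rw [← h']
    exact sSup_le_sSup fun x hx => hx.2
  · intro h v hv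
    refine ⟨fun x hx => hx.1, fun b hb => ?_⟩
    have e : v = v ⊓ sSup {x | ∃ h : x ⟶ u, S h} := by rw [h]; exact (inf_eq_left.2 hv).symm
    rw [e, inf_sSup_eq]
    refine iSup₂_le fun x hx => hb ⟨inf_le_left, ?_⟩
    obtain ⟨k, hk⟩ := hx
    exact ⟨homOfLE inf_le_right ≫ k, S.downward_closed hk _⟩

/-! ### Clopen subobjects, sections and gluing -/

section Sections

variable {C : Type w} [Category.{u} C] (τ : Precoverage C) [IsPresite τ] (X : C)

/-- The partially ordered set of clopen subobjects of `X`. -/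
abbrev ClopenSubobject : Type (max w u) := {P : Subobject X // clopen τ P.arrow}

/-- The full subcategory of the category of arrows over `X` formed by the locally clopen arrows. -/
abbrev LocallyClopenOver : Type (max w u) := (locallyClopen τ).Over ⊤ X

/-- The functor which sends a clopen subobject to a clopen arrow which represents it. -/
noncomputable def incl : ClopenSubobject τ X ⥤ LocallyClopenOver τ X where
  obj U := MorphismProperty.Over.mk ⊤ U.1.arrow (locallyClopen_of_clopen τ U.2)
  map {U V} h := MorphismProperty.Over.homMk (U.1.ofLE V.1 (leOfHom h)) (Subobject.ofLE_arrow _)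
  map_id U := by
    ext
    exact Subobject.ofLE_refl _
  map_comp f g := by
    ext
    exact (Subobject.ofLE_comp_ofLE _ _ _ _ _).symm

/-- The presheaf of sections of a locally clopen arrow over `X`: it sends a clopen subobject `U` of
`X` to the set of arrows over `X` from `U`. -/
noncomputable def sections : LocallyClopenOver τ X ⥤ (ClopenSubobject τ X)ᵒᵖ ⥤ Type u :=
  yoneda ⋙ (Functor.whiskeringLeft _ _ _).obj (incl τ X).op

/-- The category of sheaves of sets on the clopen subobjects of `X`. -/
abbrev Sh : Type (max w (u + 1)) :=
  Sheaf (canonicalTopology (ClopenSubobject τ X)) (Type u)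

variable {τ X}

/-- The pairs `⟨U, x⟩` of a clopen subobject `U` of `X` and an element `x` of `F(U)`. -/
def Index (F : (ClopenSubobject τ X)ᵒᵖ ⥤ Type u) : Type (max w u) :=
  Σ U : ClopenSubobject τ X, F.obj (op U)

/-- `⟨U, x⟩ ≤ ⟨V, y⟩` when `U ≤ V` and `x` is the restriction of `y` to `U`. -/
instance (F : (ClopenSubobject τ X)ᵒᵖ ⥤ Type u) : PartialOrder (Index F) where
  le i j := ∃ h : i.1 ≤ j.1, F.map (homOfLE h).op j.2 = i.2
  le_refl i := ⟨le_rfl, by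
    have : (homOfLE (le_refl i.1)).op = 𝟙 (op i.1) := rfl
    rw [this, F.map_id]; rfl⟩
  le_trans i j k := by
    rintro ⟨h, e⟩ ⟨h', e'⟩
    refine ⟨h.trans h', ?_⟩
    have : (homOfLE (h.trans h')).op = (homOfLE h').op ≫ (homOfLE h).op := rfl
    rw [this, F.map_comp, ← e, ← e']; rfl
  le_antisymm := by
    rintro ⟨U, x⟩ ⟨V, y⟩ ⟨h, e⟩ ⟨h', e'⟩
    obtain rfl : U = V := le_antisymm h h'
    have : (homOfLE h).op = 𝟙 (op U) := rfl
    rw [this, F.map_id] at e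
    have e : y = x := e
    rw [e]

/-- The gluing data of `F`: a copy of `U` for every index `⟨U, x⟩`, and, for every pair `i, j` of
indices with meet `k`, the subobject underlying `k` of the subobjects underlying `i` and `j`. -/
noncomputable def gluingData (F : (ClopenSubobject τ X)ᵒᵖ ⥤ Type u) :
    MultispanIndex
      { L := {p : Index F × Index F × Index F // IsGLB {p.1, p.2.1} p.2.2}
        R := Index F
        fst := fun p => p.1.1
        snd := fun p => p.1.2.1 }
      (LocallyClopenOver τ X) where
  left p := (incl τ X).obj p.1.2.2.1
  right i := (incl τ X).obj i.1
  fst p := (incl τ X).map (homOfLE (p.2.1 (by simp) : p.1.2.2 ≤ p.1.1).1)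
  snd p := (incl τ X).map (homOfLE (p.2.1 (by simp) : p.1.2.2 ≤ p.1.2.1).1)

theorem incl_map_comp_app {F : (ClopenSubobject τ X)ᵒᵖ ⥤ Type u} {E : LocallyClopenOver τ X}
    (a : F ⟶ (sections τ X).obj E) {i j : Index F} (h : i ≤ j) :
    (incl τ X).map (homOfLE h.1) ≫ (a.app (op j.1) j.2 : (incl τ X).obj j.1 ⟶ E) =
      (a.app (op i.1) i.2 : (incl τ X).obj i.1 ⟶ E) := by
  have := ConcreteCategory.congr_hom (a.naturality (homOfLE h.1).op) j.2
  rw [← h.2]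
  exact this.symm

/-- The cocone on the gluing data of `F` with vertex `E` which is given by a morphism from `F` to
the sections of `E`: its component at `⟨U, x⟩` is the section of `E` over `U` associated to `x`. -/
noncomputable def gluingCocone {F : (ClopenSubobject τ X)ᵒᵖ ⥤ Type u} {E : LocallyClopenOver τ X}
    (a : F ⟶ (sections τ X).obj E) : Multicofork (gluingData F) :=
  Multicofork.ofπ _ E (fun i => (a.app (op i.1) i.2 : (incl τ X).obj i.1 ⟶ E))
    (fun p => (incl_map_comp_app a (p.2.1 (by simp))).trans
      (incl_map_comp_app a (p.2.1 (by simp))).symm)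

end Sections

end Glutos

/-! Transport along the given equivalence reduces everything to a glutos `(G, O)` and the topos `E`
of open arrows over the image of `X`. A subterminal of `E` is an open monomorphism, that is, a
clopen subobject; a locally clopen arrow is an object of `E` generated by subterminals. The theorem
is thus the localic reflection of a topos: the objects generated by subterminals are the sheaves on
the frame of subterminals.

The reflection is proved on a small site `(D, J)` for `E` (`isSheafRepresentation_of_sheaf`). If `A`
represents the subterminal sheaves, `exists_isSupport` sends each `d : D` to its support in `A`, the
image of its representable in the terminal sheaf. Taking sections over elements of `A` turns sheaves
on `D` into sheaves on `A`. This is fully faithful on localic sheaves, whose elements locally extend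
to their supports, and these are exactly the sheaves generated by subterminals. In the other
direction, a sheaf `F` on `A` is recovered from the sheafification of `π.op ⋙ F`.

The glutos axioms serve to identify the locally clopen arrows. Openness is local on the source
(`IsGlutos.of_cover`), so locally clopen arrows lie in `E`. Epimorphisms of `E` are epimorphisms of
`G` (`IsGlutos.epi_left`), so generation by subterminals in `E` yields an actual covering in `G`.

Gluing is then formal: a cocone on the gluing data of `F` with vertex `K` is a morphism from `F` to
the sections of `K`, hence a morphism to `K` from the object that represents `F`. -/

namespace Glutos

/-! ### Supports of the objects of a site, and the frame they determine -/

section Support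

variable {D : Type u} [SmallCategory D] {A : Type w'} [PartialOrder A]

/-- `π` sends every object `d` of the site `(D, J)` to the element of `A` which represents the
smallest subsheaf of the terminal sheaf that has an element over `d`, where `A` represents the
partially ordered set of all subsheaves of the terminal sheaf. -/
structure IsSupport (J : GrothendieckTopology D) (π : D ⥤ A) : Prop where
  le_of_cover : ∀ (a : A) (d : D) (S : Sieve d), S ∈ J d →
    (∀ ⦃e : D⦄ (f : e ⟶ d), S f → π.obj e ≤ a) → π.obj d ≤ a
  cover_of_le : ∀ ⦃d e : D⦄, π.obj d ≤ π.obj e →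
    ∃ S ∈ J d, ∀ ⦃c : D⦄ (f : c ⟶ d), S f → Nonempty (c ⟶ e)
  le_of_forall : ∀ a b : A, (∀ d, π.obj d ≤ a → π.obj d ≤ b) → a ≤ b
  exists_of_closed : ∀ K : Set D, (∀ ⦃d e : D⦄, (d ⟶ e) → e ∈ K → d ∈ K) →
    (∀ (d : D) (S : Sieve d), S ∈ J d → (∀ ⦃e : D⦄ (f : e ⟶ d), S f → e ∈ K) → d ∈ K) →
    ∃ a : A, ∀ d, π.obj d ≤ a ↔ d ∈ K

variable (π : D ⥤ A)

/-- The subpresheaf of the terminal presheaf on `D` represented by an element of `A`. -/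
def support : A ⥤ Dᵒᵖ ⥤ Type u where
  obj a :=
    { obj d := ULift (PLift (π.obj d.unop ≤ a))
      map f := TypeCat.ofHom fun h => ⟨⟨(leOfHom (π.map f.unop)).trans h.down.down⟩⟩ }
  map h := { app d := TypeCat.ofHom fun k => ⟨⟨k.down.down.trans (leOfHom h)⟩⟩ }

/-- The presheaf on `A` of sections of a presheaf on `D`. -/
abbrev supportSections : (Dᵒᵖ ⥤ Type u) ⥤ Aᵒᵖ ⥤ Type u :=
  yoneda ⋙ (Functor.whiskeringLeft _ _ _).obj (support π).op

variable {π} {P Q : Dᵒᵖ ⥤ Type u}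

/-- The value of a section over `a` at an object whose support lies below `a`. -/
def germ {a : A} (s : (support π).obj a ⟶ P) {d : D} (h : π.obj d ≤ a) : P.obj (op d) :=
  s.app (op d) ⟨⟨h⟩⟩

theorem germ_map {a : A} (s : (support π).obj a ⟶ P) {d e : D} (f : e ⟶ d) (h : π.obj d ≤ a) :
    P.map f.op (germ s h) = germ s ((leOfHom (π.map f)).trans h) :=
  (ConcreteCategory.congr_hom (s.naturality f.op) ⟨⟨h⟩⟩).symm

@[ext]
theorem germ_ext {a : A} {s t : (support π).obj a ⟶ P}
    (h : ∀ (d : D) (hd : π.obj d ≤ a), germ s hd = germ t hd) : s = t := by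
  ext ⟨d⟩ ⟨⟨hd⟩⟩
  exact h d hd

/-- A section given by its values. -/
def mkSection {a : A} (x : ∀ d : D, π.obj d ≤ a → P.obj (op d))
    (hx : ∀ ⦃d e : D⦄ (f : e ⟶ d) (h : π.obj d ≤ a),
      P.map f.op (x d h) = x e ((leOfHom (π.map f)).trans h)) : (support π).obj a ⟶ P where
  app d := TypeCat.ofHom fun h => x d.unop h.down.down
  naturality d e f := by
    ext ⟨⟨h⟩⟩
    exact (hx f.unop h).symm

@[simp]
theorem germ_restrict {a b : A} (f : b ⟶ a) (s : (support π).obj a ⟶ P) {d : D}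
    (h : π.obj d ≤ b) : germ ((support π).map f ≫ s) h = germ s (h.trans (leOfHom f)) := rfl

theorem germ_map_id {a : A} (F : Aᵒᵖ ⥤ Type u) (f : a ⟶ a) (x : F.obj (op a)) :
    F.map f.op x = x := by
  have : f = 𝟙 a := Subsingleton.elim _ _
  subst this
  simp

theorem map_op_map_op_apply {A : Type*} [Category A] (F : Aᵒᵖ ⥤ Type u) {a b c : A} (f : b ⟶ a)
    (g : c ⟶ b) (x : F.obj (op a)) : F.map g.op (F.map f.op x) = F.map (g ≫ f).op x := by
  simp

variable {J : GrothendieckTopology D}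

/-- The sieve of arrows to `d` whose source has support below some element of `s`. -/
def supportSieve (π : D ⥤ A) (s : Set A) (d : D) : Sieve d where
  arrows e _ := ∃ b ∈ s, π.obj e ≤ b
  downward_closed := by
    rintro e e' f ⟨b, hb, h⟩ g
    exact ⟨b, hb, (leOfHom (π.map g)).trans h⟩

/-- The objects covered by arrows from objects supported below members of `s` form a closed class,
so `exists_of_closed` supplies the supremum. The last clause translates covers in `A` into covers
for `J`. -/
theorem IsSupport.exists_isLUB (hπ : IsSupport J π) (s : Set A) :
    ∃ a, IsLUB s a ∧ ∀ d, π.obj d ≤ a ↔ supportSieve π s d ∈ J d := by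
  obtain ⟨a, ha⟩ := hπ.exists_of_closed {d | supportSieve π s d ∈ J d} (by
    intro d e f he
    refine J.superset_covering ?_ (J.pullback_stable f he)
    rintro c g ⟨b, hb, h⟩
    exact ⟨b, hb, h⟩) (by
    intro d S hS h
    refine J.transitive hS _ ?_
    intro e f hf
    refine J.superset_covering ?_ (h f hf)
    rintro c g ⟨b, hb, h⟩
    exact ⟨b, hb, h⟩)
  refine ⟨a, ⟨fun b hb => hπ.le_of_forall _ _ fun d hd => (ha d).2 ?_, fun c hc => ?_⟩, ha⟩
  · refine J.superset_covering (S := ⊤) ?_ (J.top_mem d)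
    rintro e f -
    exact ⟨b, hb, (leOfHom (π.map f)).trans hd⟩
  · refine hπ.le_of_forall _ _ fun d hd => hπ.le_of_cover _ _ _ ((ha d).1 hd) ?_
    rintro e f ⟨b, hb, h⟩
    exact h.trans (hc hb)

theorem IsSupport.isLUB_iff (hπ : IsSupport J π) {s : Set A} {a : A} (hs : ∀ b ∈ s, b ≤ a) :
    IsLUB s a ↔ ∀ d, π.obj d ≤ a → supportSieve π s d ∈ J d := by
  obtain ⟨a', h, h'⟩ := hπ.exists_isLUB s
  constructor
  · intro ha
    obtain rfl := ha.unique h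
    exact fun d => (h' d).1
  · intro ha
    have : a = a' := le_antisymm (hπ.le_of_forall _ _ fun d hd => (h' d).2 (ha d hd)) (h.2 hs)
    exact this ▸ h

theorem IsSupport.supportSieve_mem (hπ : IsSupport J π) {a : A} {S : Sieve a}
    (hS : S ∈ canonicalTopology A a) {d : D} (hd : π.obj d ≤ a) :
    supportSieve π {x | ∃ h : x ⟶ a, S h} d ∈ J d := by
  have := (hπ.isLUB_iff (fun b hb => hb.1)).1 (hS a le_rfl) d hd
  refine J.superset_covering ?_ this
  rintro e f ⟨b, hb, h⟩
  exact ⟨b, hb.2, h⟩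

/-- Inequalities in `A` are tested on supports, and an object supported below a supremum is covered
by objects supported below its members, where distributivity is immediate. -/
theorem IsSupport.isCompleteHeyting (hπ : IsSupport J π) : IsCompleteHeyting A := by
  classical
  choose sup hsup hsup' using hπ.exists_isLUB
  let _ : SupSet A := ⟨sup⟩
  let L : CompleteLattice A := completeLatticeOfSup A hsup
  refine ⟨Order.Frame.ofMinimalAxioms { L with inf_sSup_le_iSup_inf := ?_ }, fun a b => Iff.rfl⟩
  intro a s
  refine hπ.le_of_forall _ _ fun d hd => ?_
  have h1 : π.obj d ≤ a := hd.trans inf_le_left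
  have h2 : π.obj d ≤ sup s := hd.trans inf_le_right
  refine hπ.le_of_cover _ _ _ ((hsup' s d).1 h2) ?_
  rintro e f ⟨b, hb, h⟩
  exact (le_inf ((leOfHom (π.map f)).trans h1) h).trans (le_iSup₂ (f := fun b _ => a ⊓ b) b hb)

theorem IsSupport.small (hπ : IsSupport J π) : Small.{u} A := by
  refine small_of_injective (β := Set D) (f := fun a => {d | π.obj d ≤ a}) ?_
  intro a b h
  have h : ∀ d, π.obj d ≤ a ↔ π.obj d ≤ b := fun d => Set.ext_iff.1 h d
  exact le_antisymm (hπ.le_of_forall _ _ fun d => (h d).1) (hπ.le_of_forall _ _ fun d => (h d).2)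

/-- The sections of a sheaf on `D` form a sheaf on `A`. -/
theorem IsSupport.isSheaf_supportSections (hπ : IsSupport J π) (hP : Presieve.IsSheaf J P) :
    Presieve.IsSheaf (canonicalTopology A) ((supportSections π).obj P) := by
  intro a S hS x hx
  have hx' : ∀ {b c : A} (f : b ⟶ a) (g : c ⟶ a) (hf : S f) (hg : S g) (d : D) (h : π.obj d ≤ b)
      (h' : π.obj d ≤ c), germ (x f hf) h = germ (x g hg) h' := by
    intro b c f g hf hg d h h'
    -- The two members are compared over the support of `d`, which lies below `b` and `c`, and then
    -- evaluated at `d`.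
    have := hx (homOfLE h) (homOfLE h') hf hg (Subsingleton.elim _ _)
    exact congrArg (fun s => germ (a := π.obj d) s le_rfl) this
  let y (d : D) (hd : π.obj d ≤ a) : Presieve.FamilyOfElements P
      (supportSieve π {x | ∃ h : x ⟶ a, S h} d : Presieve d) :=
    fun e f hf => germ (x hf.choose_spec.1.choose hf.choose_spec.1.choose_spec) hf.choose_spec.2
  have hy (d hd) : (y d hd).Compatible := by
    rw [Presieve.compatible_iff_sieveCompatible]
    intro e e' f g hf
    dsimp only [y]
    rw [germ_map]
    exact hx' _ _ _ _ _ _ _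
  have hc (d : D) (hd : π.obj d ≤ a) := hP _ (hπ.supportSieve_mem hS hd)
  have key (d : D) (hd : π.obj d ≤ a) {b : A} (f : b ⟶ a) (hf : S f) (hb : π.obj d ≤ b) :
      (hc d hd).amalgamate _ (hy d hd) = germ (x f hf) hb := by
    refine (hc d hd).isSeparatedFor.ext ?_
    intro e g hg
    rw [Presieve.IsSheafFor.valid_glue _ _ _ hg, germ_map]
    exact hx' _ _ _ _ _ _ _
  refine ⟨mkSection (fun d hd => (hc d hd).amalgamate _ (hy d hd)) ?_, ?_, ?_⟩
  · intro d e f hd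
    refine (hc e ((leOfHom (π.map f)).trans hd)).isSeparatedFor.ext ?_
    intro e' g hg
    have hg' : supportSieve π {x | ∃ h : x ⟶ a, S h} d (g ≫ f) := hg
    rw [Presieve.IsSheafFor.valid_glue _ _ _ hg, map_op_map_op_apply,
      Presieve.IsSheafFor.valid_glue _ _ _ hg']
  · intro b f hf
    refine germ_ext fun d hd => ?_
    exact key d (hd.trans (leOfHom f)) f hf hd
  · intro t ht
    refine germ_ext fun d hd => ?_
    refine (hc d hd).isSeparatedFor.ext ?_
    intro e g hg
    change _ = P.map g.op ((hc d hd).amalgamate _ (hy d hd))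
    rw [Presieve.IsSheafFor.valid_glue _ _ _ hg, germ_map]
    obtain ⟨b, ⟨k, hk⟩, hb⟩ := hg
    refine (congrArg (fun s => germ (a := b) s hb) (ht k hk)).trans ?_
    exact hx' _ _ _ _ _ _ _

end Support

/-! ### Sections identify localic sheaves on the site with sheaves on the frame -/

section Localic

variable {D : Type u} [SmallCategory D] {A : Type w'} [PartialOrder A] {J : GrothendieckTopology D}
  {π : D ⥤ A} {P Q : Dᵒᵖ ⥤ Type u}

/-- The sieve on which an element extends to a section over the support. -/
def extensionSieve (π : D ⥤ A) (P : Dᵒᵖ ⥤ Type u) {d : D} (x : P.obj (op d)) : Sieve d where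
  arrows e f := ∃ s : (support π).obj (π.obj e) ⟶ P, germ s le_rfl = P.map f.op x
  downward_closed := by
    rintro e c f ⟨s, hs⟩ g
    refine ⟨(support π).map (π.map g) ≫ s, ?_⟩
    rw [germ_restrict, ← germ_map s g le_rfl, hs, map_op_map_op_apply]

variable (J π) in
/-- A presheaf on `D` is localic if locally its elements extend to sections over their supports. -/
def IsLocalic (P : Dᵒᵖ ⥤ Type u) : Prop :=
  ∀ ⦃d : D⦄ (x : P.obj (op d)), extensionSieve π P x ∈ J d

/-- An object supported below the support of `d` is covered by objects mapping to `d`, where the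
value of a section is a restriction of its value at `d`. So an element has at most one extension to
its support. -/
theorem IsSupport.section_ext (hπ : IsSupport J π) (hP : Presieve.IsSheaf J P) {d : D}
    {s t : (support π).obj (π.obj d) ⟶ P} (h : germ s le_rfl = germ t le_rfl) : s = t := by
  refine germ_ext fun e he => ?_
  obtain ⟨S, hS, hS'⟩ := hπ.cover_of_le he
  refine (hP _ hS).isSeparatedFor.ext ?_
  intro c f hf
  obtain ⟨g⟩ := hS' f hf
  rw [germ_map, germ_map, ← germ_map s g le_rfl, h, germ_map]

/-- On its extension sieve an element is the value of a section, so the action on sections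
determines the morphism locally, and `Q` is separated. -/
theorem IsLocalic.supportSections_map_injective (hQ : Presieve.IsSheaf J Q)
    (hl : IsLocalic J π P) :
    Function.Injective (fun f : P ⟶ Q => (supportSections π).map f) := by
  intro f g h
  have h : (supportSections π).map f = (supportSections π).map g := h
  ext ⟨d⟩ x
  refine (hQ _ (hl x)).isSeparatedFor.ext ?_
  rintro e k ⟨s, hs⟩
  have := congrArg (fun s : (support π).obj (π.obj e) ⟶ Q => germ s le_rfl)
    (ConcreteCategory.congr_hom (NatTrans.congr_app h (op (π.obj e))) s)
  have : f.app (op e) (germ s le_rfl) = g.app (op e) (germ s le_rfl) := this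
  rw [hs] at this
  exact (NatTrans.naturality_apply f k.op x).symm.trans
    (this.trans (NatTrans.naturality_apply g k.op x))

/-- The image of an element is forced on its extension sieve: extend to a section, apply the
transformation, evaluate. Uniqueness of extensions makes these values compatible, and they glue in
`Q`. -/
theorem IsSupport.supportSections_map_surjective (hπ : IsSupport J π) (hP : Presieve.IsSheaf J P)
    (hQ : Presieve.IsSheaf J Q) (hl : IsLocalic J π P) :
    Function.Surjective (fun f : P ⟶ Q => (supportSections π).map f) := by
  intro η
  let app (a : A) (s : (support π).obj a ⟶ P) : (support π).obj a ⟶ Q := η.app (op a) s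
  have happ {a b : A} (f : b ⟶ a) (s : (support π).obj a ⟶ P) :
      app b ((support π).map f ≫ s) = (support π).map f ≫ app a s :=
    ConcreteCategory.congr_hom (η.naturality f.op) s
  let y {d : D} (x : P.obj (op d)) :
      Presieve.FamilyOfElements Q (extensionSieve π P x : Presieve d) :=
    fun e f hf => germ (app _ hf.choose) le_rfl
  -- The value depends neither on the chosen extension nor on the element `a` over which it is
  -- taken.
  have key {d : D} (x : P.obj (op d)) {e : D} (f : e ⟶ d) (hf : extensionSieve π P x f)
      {a : A} (he : π.obj e ≤ a) (s : (support π).obj a ⟶ P) (hs : germ s he = P.map f.op x) :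
      y x f hf = germ (app _ s) he := by
    have h1 : hf.choose = (support π).map (homOfLE he) ≫ s := by
      refine hπ.section_ext hP ?_
      rw [hf.choose_spec, germ_restrict, hs]
    dsimp only [y]
    rw [h1, happ, germ_restrict]
  have hy {d : D} (x : P.obj (op d)) : (y x).Compatible := by
    rw [Presieve.compatible_iff_sieveCompatible]
    intro e e' f g hf
    dsimp only [y]
    rw [germ_map]
    refine key x _ _ _ _ ?_
    rw [← germ_map _ g le_rfl, hf.choose_spec, map_op_map_op_apply]
  let m {d : D} (x : P.obj (op d)) : Q.obj (op d) := (hQ _ (hl x)).amalgamate _ (hy x)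
  have hm {d : D} (x : P.obj (op d)) {e : D} (f : e ⟶ d) (hf : extensionSieve π P x f) :
      Q.map f.op (m x) = y x f hf := Presieve.IsSheafFor.valid_glue _ _ _ hf
  have hmap {d e : D} (f : e ⟶ d) (x : P.obj (op d)) : m (P.map f.op x) = Q.map f.op (m x) := by
    refine (hQ _ (hl (P.map f.op x))).isSeparatedFor.ext ?_
    intro c g hg
    have hg' : extensionSieve π P x (g ≫ f) := by
      obtain ⟨s, hs⟩ := hg
      exact ⟨s, by rw [hs, map_op_map_op_apply]⟩
    rw [hm _ _ hg, map_op_map_op_apply, hm _ _ hg']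
    refine key _ _ _ le_rfl _ ?_
    rw [hg'.choose_spec, map_op_map_op_apply]
  refine ⟨{ app d := TypeCat.ofHom fun x => m (d := d.unop) x, naturality := ?_ }, ?_⟩
  · intro d e f
    ext x
    exact hmap f.unop x
  · ext ⟨a⟩ s
    refine germ_ext fun d hd => ?_
    change m (germ s hd) = germ (app a s) hd
    refine (hQ _ (hl (germ s hd))).isSeparatedFor.ext ?_
    intro c g hg
    rw [hm _ _ hg, germ_map]
    refine key _ _ _ _ _ ?_
    rw [germ_map]

/-- A sheaf on `A` is the sheaf of sections of the sheaf on `D` associated to the presheaf of its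
values at supports. -/
theorem IsSupport.exists_isLocalic (hπ : IsSupport J π) {F : Aᵒᵖ ⥤ Type u}
    (hF : Presieve.IsSheaf (canonicalTopology A) F) :
    ∃ P : Dᵒᵖ ⥤ Type u, Presieve.IsSheaf J P ∧ IsLocalic J π P ∧
      Nonempty (F ≅ (supportSections π).obj P) := by
  let P := sheafify J (π.op ⋙ F)
  let η : π.op ⋙ F ⟶ P := toSheafify J _
  have hP : Presieve.IsSheaf J P :=
    (isSheaf_iff_isSheaf_of_type _ _).1 ((presheafToSheaf J (Type u)).obj (π.op ⋙ F)).property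
  let t {d : D} (x : F.obj (op (π.obj d))) : P.obj (op d) := η.app (op d) x
  have ht {d e : D} (f : e ⟶ d) (x : F.obj (op (π.obj d))) :
      P.map f.op (t x) = t (F.map (π.map f).op x) := (NatTrans.naturality_apply η f.op x).symm
  -- A sieve on `a` containing the supports of the members of local covers is a covering.
  have hsep {a : A} (x y : F.obj (op a)) (h : ∀ d (hd : π.obj d ≤ a), ∃ S ∈ J d, ∀ ⦃e : D⦄
      (f : e ⟶ d), S f → ∀ he : π.obj e ≤ a,
        F.map (homOfLE he).op x = F.map (homOfLE he).op y) : x = y := by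
    let R : Sieve a :=
      { arrows b f := F.map f.op x = F.map f.op y
        downward_closed := by
          intro b c f hf g
          rw [← map_op_map_op_apply, hf, map_op_map_op_apply] }
    have hR : R ∈ canonicalTopology A a := by
      intro b hb
      refine (hπ.isLUB_iff fun c hc => hc.1).2 fun d hd => ?_
      obtain ⟨S, hS, hS'⟩ := h d (hd.trans hb)
      refine J.superset_covering ?_ hS
      intro e f hf
      exact ⟨π.obj e, ⟨(leOfHom (π.map f)).trans hd, homOfLE _, hS' f hf
        (((leOfHom (π.map f)).trans hd).trans hb)⟩, le_rfl⟩
    exact (hF R hR).isSeparatedFor.ext fun b f hf => hf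
  have hinj {d : D} (x y : F.obj (op (π.obj d))) (h : t x = t y) : x = y := by
    -- Equality after sheafification gives a cover of `d` on which `x` and `y` agree; pulled back
    -- along local maps to `d`, it covers every `e` supported below the support of `d`.
    have hs := Presheaf.equalizerSieve_mem J η (X := op d) x y h
    refine hsep x y fun e he => ?_
    obtain ⟨S, hS, hS'⟩ := hπ.cover_of_le he
    refine ⟨S ⊓ Sieve.bind (S : Presieve e) fun c f hf =>
      (Presheaf.equalizerSieve (F := π.op ⋙ F) (X := op d) x y).pullback (hS' f hf).some, ?_, ?_⟩
    · exact J.intersection_covering hS (J.bind_covering hS fun c f hf => J.pullback_stable _ hs)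
    · rintro c f ⟨-, b, g, k, hk, hg, rfl⟩ hc
      exact hg
  let σ {a : A} (x : F.obj (op a)) : (support π).obj a ⟶ P :=
    mkSection (fun d hd => t (F.map (homOfLE hd).op x)) (by
      intro d e f h
      rw [ht, map_op_map_op_apply]
      rfl)
  have hσ {d : D} (x : F.obj (op (π.obj d))) : germ (σ x) le_rfl = t x := by
    change t _ = t x
    rw [germ_map_id]
  have hloc {d : D} (x : P.obj (op d)) : ∃ S ∈ J d, ∀ ⦃e : D⦄ (f : e ⟶ d), S f →
      ∃ y : F.obj (op (π.obj e)), t y = P.map f.op x :=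
    ⟨Presheaf.imageSieve η (U := d) x, Presheaf.imageSieve_mem J η (U := op d) x, fun e f hf => hf⟩
  have hl : IsLocalic J π P := by
    intro d x
    obtain ⟨S, hS, hS'⟩ := hloc x
    refine J.superset_covering ?_ hS
    intro e f hf
    obtain ⟨y, hy⟩ := hS' f hf
    exact ⟨σ y, by rw [hσ, hy]⟩
  have hσmap {a b : A} (f : b ⟶ a) (x : F.obj (op a)) :
      σ (F.map f.op x) = (support π).map f ≫ σ x := by
    refine germ_ext fun d hd => ?_
    change t _ = t _
    rw [map_op_map_op_apply]
    rfl
  have hσinj {a : A} {x y : F.obj (op a)} (h : σ x = σ y) : x = y := by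
    refine hsep x y fun d hd => ⟨⊤, J.top_mem d, fun e f _ he => ?_⟩
    exact hinj _ _ (congrArg (fun s => germ s he) h)
  have hσsurj {a : A} (s : (support π).obj a ⟶ P) : ∃ x, σ x = s := by
    -- `R` consists of the `b` on which `s` comes from `F`. It covers because the values of `s` are
    -- locally in the image of `t` and extend uniquely to their supports.
    let R : Sieve a :=
      { arrows b f := ∃ x : F.obj (op b), σ x = (support π).map f ≫ s
        downward_closed := by
          rintro b c f ⟨x, hx⟩ g
          exact ⟨F.map g.op x, by rw [Functor.map_comp, Category.assoc, ← hx, hσmap]⟩ }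
    have hR : R ∈ canonicalTopology A a := by
      intro b hb
      refine (hπ.isLUB_iff fun c hc => hc.1).2 fun d hd => ?_
      obtain ⟨S, hS, hS'⟩ := hloc (germ s (hd.trans hb))
      refine J.superset_covering ?_ hS
      intro e f hf
      obtain ⟨y, hy⟩ := hS' f hf
      have he := (leOfHom (π.map f)).trans hd
      refine ⟨π.obj e, ⟨he, homOfLE (he.trans hb), y, hπ.section_ext hP ?_⟩, le_rfl⟩
      rw [hσ, hy, germ_map, germ_restrict]
    let y : Presieve.FamilyOfElements F (R : Presieve a) := fun b f hf => hf.choose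
    have hy : y.Compatible := by
      rw [Presieve.compatible_iff_sieveCompatible]
      intro b c f g hf
      have hfg : R (g ≫ f) := R.downward_closed hf g
      refine hσinj (hfg.choose_spec.trans ?_)
      rw [hσmap, hf.choose_spec, Functor.map_comp, Category.assoc]
    refine ⟨(hF R hR).amalgamate y hy, ?_⟩
    refine ((hπ.isSheaf_supportSections hP) R hR).isSeparatedFor.ext ?_
    intro b f hf
    refine (hσmap f _).symm.trans ?_
    rw [Presieve.IsSheafFor.valid_glue _ _ _ hf]
    exact hf.choose_spec
  have hbij (a : A) : Function.Bijective (σ (a := a)) := ⟨fun _ _ => hσinj, hσsurj⟩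
  refine ⟨P, hP, hl, ⟨NatIso.ofComponents (fun a => (Equiv.ofBijective _ (hbij a.unop)).toIso) ?_⟩⟩
  intro a b f
  ext x
  refine germ_ext fun d hd => ?_
  change t _ = t _
  congr 1
  exact map_op_map_op_apply F f.unop _ x

end Localic
/-- The sheaves of sets on a small partially ordered set form an SG-topos. -/
theorem isSGTopos_sheaf (A : Type w') [PartialOrder A] [Small.{u} A] :
    IsSGTopos.{max w' (u + 1), max w' u, u} (Sheaf (canonicalTopology A) (Type u)) := by
  have : LocallySmall.{u} A := ⟨fun a b => small_of_injective (β := PUnit) (f := fun _ => ⟨⟩)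
    fun x y _ => Subsingleton.elim x y⟩
  have : EssentiallySmall.{u} A := essentiallySmall_of_small_of_locallySmall A
  refine ⟨⟨SmallModel.{u} A, inferInstance, _, ⟨(equivSmallModel A).sheafCongr _
    ((equivSmallModel A).inverse.inducedTopology (canonicalTopology A)) _⟩⟩, ?_⟩
  intro F G f g h
  ext ⟨a⟩ x
  -- The subterminal sheaf of elements below `a`: an element of `F` over `a` is a morphism from it,
  -- so these sheaves separate.
  let K : Aᵒᵖ ⥤ Type u :=
    { obj b := ULift (PLift (b.unop ≤ a))
      map k := TypeCat.ofHom fun h => ⟨⟨(leOfHom k.unop).trans h.down.down⟩⟩ }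
  have hK : Presieve.IsSheaf (canonicalTopology A) K := by
    intro b S hS y hy
    have hb : b ≤ a := (hS b le_rfl).2 fun c hc => by
      obtain ⟨-, k, hk⟩ := hc
      exact (y k hk).down.down
    exact ⟨⟨⟨hb⟩⟩, fun _ _ _ => rfl, fun _ _ => rfl⟩
  let K' : Sheaf (canonicalTopology A) (Type u) := ⟨K, (isSheaf_iff_isSheaf_of_type _ _).2 hK⟩
  have hK' : IsSubterminal K' := by
    intro Z p q
    ext ⟨b⟩ z
    exact Subsingleton.elim _ _
  let s : K' ⟶ F := ⟨
    { app b := TypeCat.ofHom fun h => F.obj.map (homOfLE h.down.down).op x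
      naturality b c k := by
        ext ⟨⟨h⟩⟩
        exact (map_op_map_op_apply F.obj (homOfLE h) k.unop x).symm }⟩
  have e := h K' hK' s
  have e : f.hom.app (op a) (F.obj.map (homOfLE (le_refl a)).op x) =
      g.hom.app (op a) (F.obj.map (homOfLE (le_refl a)).op x) :=
    ConcreteCategory.congr_hom (NatTrans.congr_app (congrArg InducedCategory.Hom.hom e) (op a))
      ⟨⟨le_rfl⟩⟩
  rw [germ_map_id] at e
  exact e

/-! ### Subterminal sheaves, and generation by them as localicity -/

section Subterminal

/-- An object is generated by subterminals when the morphisms to it from subterminal objects are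
jointly epimorphic. -/
def IsSubterminalGenerated {E : Type w} [Category.{v'} E] (P : E) : Prop :=
  ∀ ⦃Q : E⦄ (f g : P ⟶ Q), (∀ ⦃K : E⦄, IsSubterminal K → ∀ s : K ⟶ P, s ≫ f = s ≫ g) → f = g

variable {D : Type u} [SmallCategory D] {J : GrothendieckTopology D}

/-- Elements over `d` are morphisms from the sheafified representable of `d`. -/
theorem subsingleton_of_isSubterminal {K : Sheaf J (Type u)} (hK : IsSubterminal K) (d : D) :
    Subsingleton (K.obj.obj (op d)) := by
  let e := (((sheafificationAdjunction J (Type u)).homEquiv (yoneda.obj d) K).trans yonedaEquiv)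
  exact ⟨fun x y => e.symm.injective (hK _ _)⟩

theorem isSubterminal_of_subsingleton {K : Sheaf J (Type u)}
    (hK : ∀ d : D, Subsingleton (K.obj.obj (op d))) : IsSubterminal K := by
  intro Z p q
  ext ⟨b⟩ z
  exact (hK b).elim _ _

/-- The subterminal sheaf given by a closed class of objects. -/
theorem exists_isSubterminal (K : Set D) (h : ∀ ⦃d e : D⦄, (d ⟶ e) → e ∈ K → d ∈ K)
    (h' : ∀ (d : D) (S : Sieve d), S ∈ J d → (∀ ⦃e : D⦄ (f : e ⟶ d), S f → e ∈ K) → d ∈ K) :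
    ∃ P : Sheaf J (Type u), IsSubterminal P ∧ ∀ d, Nonempty (P.obj.obj (op d)) ↔ d ∈ K := by
  let P : Dᵒᵖ ⥤ Type u :=
    { obj b := ULift (PLift (b.unop ∈ K))
      map k := TypeCat.ofHom fun x => ⟨⟨h k.unop x.down.down⟩⟩ }
  have hP : Presieve.IsSheaf J P := fun d S hS y hy =>
    ⟨⟨⟨h' d S hS fun e k hk => (y k hk).down.down⟩⟩, fun _ _ _ => rfl, fun _ _ => rfl⟩
  exact ⟨⟨P, (isSheaf_iff_isSheaf_of_type _ _).2 hP⟩,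
    isSubterminal_of_subsingleton fun d => ⟨fun ⟨⟨_⟩⟩ ⟨⟨_⟩⟩ => rfl⟩,
    fun d => ⟨fun ⟨x⟩ => x.down.down, fun hd => ⟨⟨⟨hd⟩⟩⟩⟩⟩

variable {A : Type w'} [PartialOrder A]

/-- Every representation of the subterminal sheaves by a partially ordered set gives a support. -/
theorem exists_isSupport (i : A ⥤ Sheaf J (Type u)) [i.Full] (hi : ∀ a, IsSubterminal (i.obj a))
    (hi' : ∀ K : Sheaf J (Type u), IsSubterminal K → ∃ a, Nonempty (i.obj a ≅ K)) :
    ∃ π : D ⥤ A, IsSupport J π ∧ Nonempty (support π ≅ i ⋙ sheafToPresheaf _ _) := by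
  have hs (a : A) (d : D) := subsingleton_of_isSubterminal (hi a) d
  have hle (a b : A) (h : ∀ d, Nonempty ((i.obj a).obj.obj (op d)) →
      Nonempty ((i.obj b).obj.obj (op d))) : a ≤ b := by
    refine leOfHom (i.preimage ⟨{
      app d := TypeCat.ofHom fun x => (h d.unop ⟨x⟩).some
      naturality d e f := by
        ext x
        exact (hs b e.unop).elim _ _ }⟩)
  have hne {a b : A} (h : a ≤ b) {d : D} (x : (i.obj a).obj.obj (op d)) :
      Nonempty ((i.obj b).obj.obj (op d)) := ⟨(i.map (homOfLE h)).hom.app _ x⟩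
  have hK (K : Set D) (h : ∀ ⦃d e : D⦄, (d ⟶ e) → e ∈ K → d ∈ K)
      (h' : ∀ (d : D) (S : Sieve d), S ∈ J d → (∀ ⦃e : D⦄ (f : e ⟶ d), S f → e ∈ K) → d ∈ K) :
      ∃ a, ∀ d, Nonempty ((i.obj a).obj.obj (op d)) ↔ d ∈ K := by
    obtain ⟨P, hP, hPK⟩ := exists_isSubterminal K h h'
    obtain ⟨a, ⟨e⟩⟩ := hi' P hP
    refine ⟨a, fun d => ?_⟩
    rw [← hPK]
    exact ⟨fun ⟨x⟩ => ⟨e.hom.hom.app _ x⟩, fun ⟨x⟩ => ⟨e.inv.hom.app _ x⟩⟩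
  have hglue (a : A) (d : D) (S : Sieve d) (hS : S ∈ J d)
      (h : ∀ ⦃e : D⦄ (f : e ⟶ d), S f → Nonempty ((i.obj a).obj.obj (op e))) :
      Nonempty ((i.obj a).obj.obj (op d)) := by
    have := (isSheaf_iff_isSheaf_of_type _ _).1 (i.obj a).property
    exact ⟨(this S hS).amalgamate (fun e f hf => (h f hf).some)
      (fun _ _ c _ _ _ _ _ _ _ => (hs a c).elim _ _)⟩
  -- The support of `d` consists of the objects that locally map to `d`; by `hpa` below it is the
  -- least subterminal with an element over `d`.
  have hc (d : D) : ∃ a, ∀ e, Nonempty ((i.obj a).obj.obj (op e)) ↔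
      ∃ S ∈ J e, ∀ ⦃c : D⦄ (f : c ⟶ e), S f → Nonempty (c ⟶ d) := by
    let s (e : D) : Sieve e :=
      { arrows c _ := Nonempty (c ⟶ d)
        downward_closed := fun ⟨h⟩ g => ⟨g ≫ h⟩ }
    have hs (e : D) : (∃ S ∈ J e, ∀ ⦃c : D⦄ (f : c ⟶ e), S f → Nonempty (c ⟶ d)) ↔ s e ∈ J e :=
      ⟨fun ⟨S, hS, h⟩ => J.superset_covering (fun c f hf => h f hf) hS,
        fun h => ⟨_, h, fun c f hf => hf⟩⟩
    simp only [hs]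
    refine hK {e | s e ∈ J e} ?_ ?_
    · intro e c f hc
      exact J.pullback_stable f hc
    · intro e S hS h
      exact J.transitive hS _ fun c f hf => h f hf
  choose p hp using hc
  have hpa (d : D) (a : A) : p d ≤ a ↔ Nonempty ((i.obj a).obj.obj (op d)) := by
    constructor
    · intro h
      obtain ⟨x⟩ := (hp d d).2 ⟨⊤, J.top_mem d, fun c f _ => ⟨f⟩⟩
      exact hne h x
    · rintro ⟨x⟩
      refine hle _ _ fun e he => ?_
      obtain ⟨S, hS, hS'⟩ := (hp d e).1 he
      exact hglue _ _ S hS fun c f hf => ⟨(i.obj a).obj.map (hS' f hf).some.op x⟩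
  let π : D ⥤ A :=
    { obj := p
      map {d e} f := homOfLE ((hpa d _).2
        ⟨(i.obj (p e)).obj.map f.op ((hpa e _).1 le_rfl).some⟩) }
  refine ⟨π, ⟨?_, ?_, ?_, ?_⟩, ⟨NatIso.ofComponents (fun a => NatIso.ofComponents
    (fun d => Equiv.toIso ⟨fun h => ((hpa d.unop a).1 h.down.down).some,
      fun x => ⟨⟨(hpa _ _).2 ⟨x⟩⟩⟩, fun _ => rfl, fun _ => (hs a d.unop).elim _ _⟩) ?_) ?_⟩⟩
  · intro a d S hS h
    exact (hpa d a).2 (hglue a d S hS fun e f hf => (hpa e a).1 (h f hf))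
  · intro d e h
    exact (hp e d).1 ((hpa d _).1 h)
  · intro a b h
    exact hle a b fun d hd => (hpa d b).1 (h d ((hpa d a).2 hd))
  · intro K h h'
    obtain ⟨a, ha⟩ := hK K h h'
    exact ⟨a, fun d => (hpa d a).trans (ha d)⟩
  · intro d e f
    ext x
    exact (hs a e.unop).elim _ _
  · intro a b f
    ext d x
    exact (hs b d).elim _ _

variable {π : D ⥤ A}

/-- A section over a support is a morphism from a subterminal sheaf, and locally every element is a
value of such a section. -/
theorem IsLocalic.isSubterminalGenerated (hπ : ∀ a, Presieve.IsSheaf J ((support π).obj a))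
    {P : Sheaf J (Type u)} (hP : IsLocalic J π P.obj) : IsSubterminalGenerated P := by
  intro Q f g h
  have hQ := (isSheaf_iff_isSheaf_of_type _ _).1 Q.property
  ext ⟨d⟩ x
  refine (hQ _ (hP x)).isSeparatedFor.ext ?_
  rintro e k ⟨s, hs⟩
  have := h (K := ⟨(support π).obj (π.obj e), (isSheaf_iff_isSheaf_of_type _ _).2 (hπ _)⟩)
    (isSubterminal_of_subsingleton fun d => ⟨fun ⟨⟨_⟩⟩ ⟨⟨_⟩⟩ => rfl⟩) ⟨s⟩
  have : f.hom.app (op e) (germ s le_rfl) = g.hom.app (op e) (germ s le_rfl) :=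
    ConcreteCategory.congr_hom (NatTrans.congr_app (congrArg InducedCategory.Hom.hom this) (op e))
      ⟨⟨le_rfl⟩⟩
  rw [hs] at this
  exact (NatTrans.naturality_apply f.hom k.op x).symm.trans
    (this.trans (NatTrans.naturality_apply g.hom k.op x))

/-- The elements that extend to their supports form a subpresheaf containing the image of every
morphism from a subterminal. The inclusion of its saturation is therefore an epimorphism of sheaves,
hence locally surjective. -/
theorem IsSubterminalGenerated.isLocalic
    (hπ : ∀ K : Sheaf J (Type u), IsSubterminal K → ∃ a, Nonempty ((support π).obj a ≅ K.obj))
    {P : Sheaf J (Type u)} (hP : IsSubterminalGenerated P) : IsLocalic J π P.obj := by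
  have hP' := (isSheaf_iff_isSheaf_of_type _ _).1 P.property
  let R : Subfunctor P.obj :=
    { obj d := {x | ∃ s : (support π).obj (π.obj d.unop) ⟶ P.obj, germ s le_rfl = x}
      map := by
        rintro d e f _ ⟨s, rfl⟩
        refine ⟨(support π).map (π.map f.unop) ≫ s, ?_⟩
        exact (germ_map s f.unop le_rfl).symm }
  let R' : Sheaf J (Type u) := ⟨(R.sheafify J).toFunctor, (isSheaf_iff_isSheaf_of_type _ _).2
    (R.sheafify_isSheaf hP')⟩
  let ι : R' ⟶ P := ⟨(R.sheafify J).ι⟩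
  have hι : Epi ι := by
    refine ⟨fun {Q} f g h => hP f g fun K hK s => ?_⟩
    obtain ⟨a, ⟨e⟩⟩ := hπ K hK
    ext ⟨d⟩ x
    have hx : s.hom.app (op d) x ∈ (R.sheafify J).obj (op d) := by
      refine R.le_sheafify J (op d) ?_
      refine ⟨(support π).map (homOfLE (e.inv.app (op d) x).down.down) ≫ e.hom ≫ s.hom, ?_⟩
      change s.hom.app (op d) (e.hom.app (op d) (e.inv.app (op d) x)) = _
      have : e.hom.app (op d) (e.inv.app (op d) x) = x :=
        ConcreteCategory.congr_hom (e.inv_hom_id_app (op d)) x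
      rw [this]
    exact ConcreteCategory.congr_hom (NatTrans.congr_app (congrArg InducedCategory.Hom.hom h)
      (op d)) ⟨_, hx⟩
  have hι' : Sheaf.IsLocallySurjective ι :=
    (Sheaf.isLocallySurjective_iff_epi' (A := Type u) ι).2 hι
  intro d x
  have : Presheaf.imageSieve ι.hom x ∈ J d := Presheaf.imageSieve_mem J ι.hom (U := op d) x
  refine J.transitive this _ ?_
  rintro e f ⟨⟨y, hy⟩, rfl : y = _⟩
  refine J.superset_covering ?_ hy
  rintro c g ⟨s, hs⟩
  exact ⟨s, hs.trans (map_op_map_op_apply _ _ _ _)⟩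

end Subterminal

/-! ### Invariance under equivalence -/

section Transfer

variable {E : Type w} [Category.{v'} E] {E' : Type w''} [Category.{v''} E']

theorem isSubterminal_map (e : E ≌ E') {K : E} (hK : IsSubterminal K) :
    IsSubterminal (e.functor.obj K) := by
  intro _ f g
  have h := hK (e.inverse.map f ≫ e.unitInv.app K) (e.inverse.map g ≫ e.unitInv.app K)
  rw [cancel_mono] at h
  exact e.inverse.map_injective h

theorem isSubterminalGenerated_map (e : E ≌ E') {P : E} (hP : IsSubterminalGenerated P) :
    IsSubterminalGenerated (e.functor.obj P) := by
  intro Q f g h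
  have := hP (e.unit.app P ≫ e.inverse.map f) (e.unit.app P ≫ e.inverse.map g) fun K hK s => by
    have h := congrArg (fun k => e.unit.app K ≫ e.inverse.map k)
      (h (isSubterminal_map e hK) (e.functor.map s))
    simpa using h
  rw [cancel_epi] at this
  exact e.inverse.map_injective this

end Transfer

/-! ### The localic reflection of a topos -/

section Represent

variable {A : Type w'} [PartialOrder A] {T : Type w} [Category.{u} T]

/-- The presheaf on `A` represented by an object of `T` via `i : A ⥤ T`. -/
abbrev restrictedYoneda (i : A ⥤ T) : T ⥤ Aᵒᵖ ⥤ Type u :=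
  yoneda ⋙ (Functor.whiskeringLeft _ _ _).obj i.op

/-- The restricted Yoneda functor of `i` identifies `T` with the category of sheaves on the complete
Heyting algebra `A`. -/
structure IsSheafRepresentation (i : A ⥤ T) : Prop where
  small : Small.{u} A
  isCompleteHeyting : IsCompleteHeyting A
  isSheaf : ∀ t, Presieve.IsSheaf (canonicalTopology A) ((restrictedYoneda i).obj t)
  full : (restrictedYoneda i).Full
  faithful : (restrictedYoneda i).Faithful
  exists_iso : ∀ F : Aᵒᵖ ⥤ Type u, Presieve.IsSheaf (canonicalTopology A) F →
    ∃ t, Nonempty ((restrictedYoneda i).obj t ≅ F)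

/-- Restricted Yoneda functors may be computed in the sheaf topos. -/
noncomputable def restrictedYonedaIso {D : Type u} [SmallCategory D] {J : GrothendieckTopology D}
    (i : A ⥤ T)
    (Φ : T ⥤ Sheaf J (Type u)) [Φ.Full] [Φ.Faithful] {π : D ⥤ A}
    (σ : support π ≅ (i ⋙ Φ) ⋙ sheafToPresheaf _ _) :
    restrictedYoneda i ≅ Φ ⋙ sheafToPresheaf _ _ ⋙ supportSections π :=
  NatIso.ofComponents (fun t => NatIso.ofComponents
    (fun a => (((Functor.FullyFaithful.ofFullyFaithful Φ).comp
      (fullyFaithfulSheafToPresheaf J _)).homEquiv.trans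
        ((σ.app a.unop).symm.homFromEquiv)).toIso) (by
      intro a b f
      ext s
      have := σ.hom.naturality f.unop
      change σ.hom.app _ ≫ (Φ.map (i.map f.unop ≫ s)).hom =
        (support π).map f.unop ≫ σ.hom.app _ ≫ (Φ.map s).hom
      rw [reassoc_of% this]
      simp)) (by
    intro s t f
    ext a g
    change σ.hom.app _ ≫ (Φ.map (g ≫ f)).hom = (σ.hom.app _ ≫ (Φ.map g).hom) ≫ (Φ.map f).hom
    simp)

/-- The restricted Yoneda functor is `Φ` followed by sections. By `h3` the image of `Φ` is localic,
where sections are fully faithful; `h4` lifts to `T` the localic sheaf built from a sheaf on `A`. -/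
theorem isSheafRepresentation_of_sheaf {D : Type u} [SmallCategory D] {J : GrothendieckTopology D}
    (i : A ⥤ T) [i.Full] (Φ : T ⥤ Sheaf J (Type u)) [Φ.Full] [Φ.Faithful]
    (h1 : ∀ a, IsSubterminal (Φ.obj (i.obj a)))
    (h2 : ∀ P : Sheaf J (Type u), IsSubterminal P → ∃ a, Nonempty (Φ.obj (i.obj a) ≅ P))
    (h3 : ∀ t, IsSubterminalGenerated (Φ.obj t))
    (h4 : ∀ P : Sheaf J (Type u), IsSubterminalGenerated P → ∃ t, Nonempty (Φ.obj t ≅ P)) :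
    IsSheafRepresentation i := by
  obtain ⟨π, hπ, ⟨σ⟩⟩ := exists_isSupport (i ⋙ Φ) h1 h2
  have hs (P : Sheaf J (Type u)) : Presieve.IsSheaf J P.obj :=
    (isSheaf_iff_isSheaf_of_type _ _).1 P.property
  have hσ (a : A) : Presieve.IsSheaf J ((support π).obj a) :=
    Presieve.isSheaf_iso J (σ.app a).symm (hs (Φ.obj (i.obj a)))
  have hl (t : T) : IsLocalic J π (Φ.obj t).obj := (h3 t).isLocalic fun K hK => by
    obtain ⟨a, ⟨e⟩⟩ := h2 K hK
    exact ⟨a, ⟨σ.app a ≪≫ (sheafToPresheaf _ _).mapIso e⟩⟩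
  let Γ := restrictedYonedaIso i Φ σ
  have hfull : (Φ ⋙ sheafToPresheaf _ _ ⋙ supportSections π).Full := ⟨fun {s t} η => by
    obtain ⟨f, hf⟩ := hπ.supportSections_map_surjective (hs _) (hs _) (hl s) η
    exact ⟨Φ.preimage ⟨f⟩, by simpa using hf⟩⟩
  have hfaith : (Φ ⋙ sheafToPresheaf _ _ ⋙ supportSections π).Faithful := ⟨fun {s t f g} h =>
    Φ.map_injective ((sheafToPresheaf _ _).map_injective
      ((hl s).supportSections_map_injective (hs _) h))⟩
  refine ⟨hπ.small, hπ.isCompleteHeyting, fun t => ?_, Functor.Full.of_iso Γ.symm,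
    Functor.Faithful.of_iso Γ.symm, fun F hF => ?_⟩
  · exact Presieve.isSheaf_iso _ (Γ.app t).symm (hπ.isSheaf_supportSections (hs (Φ.obj t)))
  · obtain ⟨P, hP, hP', ⟨e⟩⟩ := hπ.exists_isLocalic hF
    obtain ⟨t, ⟨e'⟩⟩ := h4 ⟨P, (isSheaf_iff_isSheaf_of_type _ _).2 hP⟩
      (IsLocalic.isSubterminalGenerated hσ hP')
    exact ⟨t, ⟨Γ.app t ≪≫ (sheafToPresheaf _ _ ⋙ supportSections π).mapIso e' ≪≫ e.symm⟩⟩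

theorem isSheafRepresentation_of_isTopos {E : Type w''} [Category.{v''} E]
    (hE : IsTopos.{w'', v'', u} E) (i : A ⥤ T) [i.Full] (Φ : T ⥤ E) [Φ.Full] [Φ.Faithful]
    (h1 : ∀ a, IsSubterminal (Φ.obj (i.obj a)))
    (h2 : ∀ P : E, IsSubterminal P → ∃ a, Nonempty (Φ.obj (i.obj a) ≅ P))
    (h3 : ∀ t, IsSubterminalGenerated (Φ.obj t))
    (h4 : ∀ P : E, IsSubterminalGenerated P → ∃ t, Nonempty (Φ.obj t ≅ P)) :
    IsSheafRepresentation i := by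
  obtain ⟨D, _, J, ⟨e⟩⟩ := hE
  refine isSheafRepresentation_of_sheaf i (Φ ⋙ e.functor) (fun a => isSubterminal_map e (h1 a))
    (fun P hP => ?_) (fun t => isSubterminalGenerated_map e (h3 t)) fun P hP => ?_
  · obtain ⟨a, ⟨k⟩⟩ := h2 (e.inverse.obj P) (isSubterminal_map e.symm hP)
    exact ⟨a, ⟨e.functor.mapIso k ≪≫ e.counitIso.app P⟩⟩
  · obtain ⟨a, ⟨k⟩⟩ := h4 (e.inverse.obj P) (isSubterminalGenerated_map e.symm hP)
    exact ⟨a, ⟨e.functor.mapIso k ≪≫ e.counitIso.app P⟩⟩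

end Represent

/-! ### Meets of indices and the gluing colimit -/

section Gluing

theorem exists_isLUB_mem_canonicalTopology {A : Type w'} [Order.Frame A] (p : A → Prop) :
    ∃ a, IsLUB {x | p x} a ∧ ∀ R : Sieve a, (∀ (c : A) (f : c ⟶ a), p c → R f) →
      R ∈ canonicalTopology A a := by
  refine ⟨sSup {x | p x}, isLUB_sSup _, fun R hR => ?_⟩
  rw [mem_canonicalTopology_iff]
  refine le_antisymm (sSup_le fun x hx => leOfHom hx.choose) (sSup_le_sSup fun x hx => ?_)
  exact ⟨homOfLE (le_sSup hx), hR _ _ hx⟩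

theorem IsCompleteHeyting.exists_isLUB_mem {A : Type w'} [o : PartialOrder A]
    (hA : IsCompleteHeyting A) (p : A → Prop) :
    ∃ a, IsLUB {x | p x} a ∧ ∀ R : Sieve a, (∀ (c : A) (f : c ⟶ a), p c → R f) →
      R ∈ canonicalTopology A a := by
  obtain ⟨F, hF⟩ := hA
  obtain rfl : F.toPartialOrder = o := PartialOrder.ext hF
  exact exists_isLUB_mem_canonicalTopology p

/-- Pairwise meets of indices exist: the meet lives over the largest clopen subobject on which the
two elements agree. -/
theorem exists_isGLB_index {C : Type w} [Category.{u} C] {τ : Precoverage C} {X : C}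
    (hA : IsCompleteHeyting (ClopenSubobject τ X)) (F : Sh τ X)
    (i j : Index F.obj) : ∃ k, IsGLB {i, j} k := by
  have hF := (isSheaf_iff_isSheaf_of_type _ _).1 F.property
  obtain ⟨U, x⟩ := i
  obtain ⟨V, y⟩ := j
  obtain ⟨W, hW, hW'⟩ := hA.exists_isLUB_mem (fun W => ∃ (h : W ≤ U) (h' : W ≤ V),
    F.obj.map (homOfLE h).op x = F.obj.map (homOfLE h').op y)
  have hU : W ≤ U := hW.2 fun c hc => hc.1
  have hV : W ≤ V := hW.2 fun c hc => hc.2.1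
  let R : Sieve W :=
    { arrows b f := F.obj.map (f ≫ homOfLE hU).op x = F.obj.map (f ≫ homOfLE hV).op y
      downward_closed := by
        intro b c f hf g
        rw [Category.assoc, ← map_op_map_op_apply, hf, map_op_map_op_apply, Category.assoc] }
  have hR : R ∈ canonicalTopology _ W := hW' R fun c f hc => hc.2.2
  have hxy : F.obj.map (homOfLE hU).op x = F.obj.map (homOfLE hV).op y := by
    refine (hF R hR).isSeparatedFor.ext fun b f hf => ?_
    rw [map_op_map_op_apply, map_op_map_op_apply]
    exact hf
  refine ⟨⟨W, F.obj.map (homOfLE hU).op x⟩, ?_, ?_⟩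
  · rintro _ (rfl | rfl)
    · exact ⟨hU, rfl⟩
    · exact ⟨hV, hxy.symm⟩
  · rintro ⟨c, z⟩ hc
    obtain ⟨h, e⟩ := hc (Set.mem_insert _ _)
    obtain ⟨h', e'⟩ := hc (Set.mem_insert_of_mem _ rfl)
    exact ⟨hW.1 ⟨h, h', e.trans e'.symm⟩, (map_op_map_op_apply _ _ _ _).trans e⟩

variable {C : Type w} [Category.{u} C] {τ : Precoverage C} [IsPresite τ] {X : C}

/-- If a sheaf is isomorphic to the sheaf of sections of `E`, then `E` is obtained by gluing. -/
noncomputable def isColimitGluingCocone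
    (h : IsSheafRepresentation (incl τ X)) {F : (ClopenSubobject τ X)ᵒᵖ ⥤ Type u}
    {E : LocallyClopenOver τ X} (a : F ⟶ (sections τ X).obj E) [IsIso a] :
    IsColimit (gluingCocone a) := by
  have := h.full
  have := h.faithful
  have hK (K : Multicofork (gluingData F)) {i j : Index F} (hij : i ≤ j) :
      (incl τ X).map (homOfLE hij.1) ≫ K.π j = K.π i := by
    -- For `i ≤ j` the meet is `i`, so the gluing relation for this pair says that the legs are
    -- compatible with restriction.
    have hglb : IsGLB {i, j} i :=
      ⟨by rintro _ (rfl | rfl); exacts [le_rfl, hij], fun k hk => hk (Set.mem_insert _ _)⟩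
    have := K.condition ⟨(i, j, i), hglb⟩
    refine this.symm.trans ?_
    exact (congrArg (· ≫ K.π i) ((incl τ X).map_id i.1)).trans (Category.id_comp _)
  -- Compatible legs are a morphism of presheaves; as `F` is the sections of `E`, full faithfulness
  -- turns it into a unique morphism from `E`.
  let θ (K : Multicofork (gluingData F)) : F ⟶ (restrictedYoneda (incl τ X)).obj K.pt :=
    { app U := TypeCat.ofHom fun x => K.π (⟨U.unop, x⟩ : Index F)
      naturality U V f := by
        ext x
        exact (hK K (i := ⟨V.unop, F.map f x⟩) (j := ⟨U.unop, x⟩) ⟨leOfHom f.unop, rfl⟩).symm }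
  let a' : F ⟶ (restrictedYoneda (incl τ X)).obj E := a
  have : IsIso a' := ‹IsIso a›
  let d (K : Multicofork (gluingData F)) : E ⟶ K.pt :=
    (restrictedYoneda (incl τ X)).preimage (inv a' ≫ θ K)
  have hd (K : Multicofork (gluingData F)) : a' ≫ (restrictedYoneda (incl τ X)).map (d K) = θ K := by
    rw [Functor.map_preimage, IsIso.hom_inv_id_assoc]
  refine Multicofork.IsColimit.mk _ d ?_ ?_
  · intro K i
    exact ConcreteCategory.congr_hom (NatTrans.congr_app (hd K) (op i.1)) i.2
  · intro K m hm
    refine (restrictedYoneda (incl τ X)).map_injective ?_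
    refine (cancel_epi a').1 (Eq.trans ?_ (hd K).symm)
    ext U x
    exact hm ⟨U.unop, x⟩

theorem IsSheafRepresentation.exists_equivalence (h : IsSheafRepresentation (incl τ X)) :
    Small.{u} (ClopenSubobject τ X) ∧
    IsCompleteHeyting (ClopenSubobject τ X) ∧
    IsSGTopos.{max w (u + 1), max w u, u} (Sh τ X) ∧
    ∃ (J : Sh τ X ⥤ LocallyClopenOver τ X)
      (β : sheafToPresheaf _ _ ≅ J ⋙ sections τ X),
      J.IsEquivalence ∧
      ∀ F : Sh τ X,
        (∀ i j : Index F.obj, ∃ k, IsGLB {i, j} k) ∧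
        Nonempty (IsColimit (gluingCocone (β.hom.app F))) := by
  have := h.small
  let Γ : LocallyClopenOver τ X ⥤ Sh τ X := ObjectProperty.lift _ (restrictedYoneda (incl τ X))
    fun t => (isSheaf_iff_isSheaf_of_type _ _).2 (h.isSheaf t)
  have := h.full
  have := h.faithful
  have : Γ.Full := ⟨fun {s t} f => by
    obtain ⟨g, hg⟩ := (restrictedYoneda (incl τ X)).map_surjective f.hom
    exact ⟨g, (sheafToPresheaf _ _).map_injective hg⟩⟩
  have : Γ.Faithful := ⟨fun {s t f g} hfg =>
    (restrictedYoneda (incl τ X)).map_injective (congrArg (sheafToPresheaf _ _).map hfg)⟩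
  have : Γ.EssSurj := ⟨fun F => by
    obtain ⟨t, ⟨e⟩⟩ := h.exists_iso F.obj ((isSheaf_iff_isSheaf_of_type _ _).1 F.property)
    exact ⟨t, ⟨(fullyFaithfulSheafToPresheaf _ _).preimageIso e⟩⟩⟩
  have : Γ.IsEquivalence := {}
  let β : sheafToPresheaf _ _ ≅ Γ.inv ⋙ sections τ X :=
    Functor.isoWhiskerRight Γ.asEquivalence.counitIso.symm (sheafToPresheaf _ _)
  refine ⟨h.small, h.isCompleteHeyting, isSGTopos_sheaf _, Γ.inv, β, inferInstance,
    fun F => ⟨exists_isGLB_index h.isCompleteHeyting F, ⟨isColimitGluingCocone h _⟩⟩⟩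

end Gluing

/-! ### Subterminals and epimorphisms in a topos -/

section Topos

variable {E : Type w} [Category.{v'} E]

theorem exists_hom_of_isSubterminal {D : Type u} [SmallCategory D] {J : GrothendieckTopology D}
    {K L : Sheaf J (Type u)} (hL : IsSubterminal L)
    (h : ∀ d, Nonempty (K.obj.obj (op d)) → Nonempty (L.obj.obj (op d))) : Nonempty (K ⟶ L) :=
  ⟨⟨{ app d := TypeCat.ofHom fun x => (h d.unop ⟨x⟩).some
      naturality d e f := by
        ext x
        exact (subsingleton_of_isSubterminal hL e.unop).elim _ _ }⟩⟩

/-- Up to isomorphism, a topos has only a small set of subterminal objects. -/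
theorem IsTopos.exists_small_subterminals (hE : IsTopos.{w, v', u} E) :
    ∃ (ι : Type u) (K : ι → E), (∀ i, IsSubterminal (K i)) ∧
      ∀ L : E, IsSubterminal L → ∃ i, Nonempty (K i ≅ L) := by
  obtain ⟨D, _, J, ⟨e⟩⟩ := hE
  -- A subterminal sheaf is determined up to isomorphism by the objects over which it has an
  -- element.
  let ι : Type u := {S : Set D // ∃ L : Sheaf J (Type u), IsSubterminal L ∧
    ∀ d, d ∈ S ↔ Nonempty (L.obj.obj (op d))}
  choose K hK hK' using fun i : ι => i.2
  refine ⟨ι, fun i => e.inverse.obj (K i), fun i => isSubterminal_map e.symm (hK i),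
    fun L hL => ?_⟩
  have hL' := isSubterminal_map e hL
  let i : ι := ⟨{d | Nonempty ((e.functor.obj L).obj.obj (op d))}, _, hL', fun d => Iff.rfl⟩
  obtain ⟨f⟩ := exists_hom_of_isSubterminal (K := K i) hL' fun d => (hK' i d).2
  obtain ⟨g⟩ := exists_hom_of_isSubterminal (L := K i) (hK i) fun d => (hK' i d).1
  exact ⟨i, ⟨e.inverse.mapIso ⟨f, g, hK i _ _, hL' _ _⟩ ≪≫ (e.unitIso.app L).symm⟩⟩

/-- In a topos, a morphism which identifies all pairs that an epimorphism `p` identifies factors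
through `p`. -/
theorem IsTopos.exists_desc (hE : IsTopos.{w, v', u} E) {V P Q : E} (p : V ⟶ P) [Epi p]
    (q : V ⟶ Q) (h : ∀ ⦃T : E⦄ (s t : T ⟶ V), s ≫ p = t ≫ p → s ≫ q = t ≫ q) :
    ∃ n : P ⟶ Q, p ≫ n = q := by
  obtain ⟨D, _, J, ⟨e⟩⟩ := hE
  -- Epimorphisms of sheaves of sets are regular, so only the pair they coequalize has to be tested.
  have r := regularEpiOfEpi (e.functor.map p)
  have hr : r.left ≫ e.functor.map q = r.right ≫ e.functor.map q := by
    refine e.inverse.map_injective ?_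
    have h1 := h (e.inverse.map r.left ≫ e.unitInv.app V) (e.inverse.map r.right ≫ e.unitInv.app V)
      (by
        have := congrArg (fun k => e.inverse.map k ≫ e.unitInv.app P) r.w
        simpa using this)
    have := congrArg (fun k => k ≫ e.unit.app Q) h1
    simpa using this
  let n := Cofork.IsColimit.desc r.isColimit _ hr
  refine ⟨e.functor.preimage n, e.functor.map_injective ?_⟩
  rw [Functor.map_comp, Functor.map_preimage]
  exact Cofork.IsColimit.π_desc' r.isColimit _ hr

end Topos

/-! ### Open arrows in a glutos: subterminals, epimorphisms, coverings -/

section OpenArrows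

variable {G : Type w} [Category.{u} G] {O : MorphismProperty G}

/-- Adjoining the identity to an open monomorphism makes the sink epi without leaving the open
monomorphisms. -/
theorem clopen_monoPart_iff [O.ContainsIdentities] {U X : G} (f : U ⟶ X) :
    clopen (monoPart (openEpi O)) f ↔ O f ∧ Mono f := by
  constructor
  · rintro ⟨S, ⟨⟨hS, -⟩, hS'⟩, hf⟩
    exact ⟨hS hf, hS' hf⟩
  · rintro ⟨hf, hf'⟩
    refine ⟨.singleton f ⊔ .singleton (𝟙 X), ⟨⟨?_, ?_⟩, ?_⟩, Or.inl ⟨⟩⟩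
    · rintro _ _ (⟨⟨⟩⟩ | ⟨⟨⟩⟩)
      exacts [hf, O.id_mem X]
    · intro Z a b h
      simpa using h (f := 𝟙 X) (Or.inr ⟨⟩)
    · rintro _ _ (⟨⟨⟩⟩ | ⟨⟨⟩⟩)
      exacts [hf', inferInstance]

/-- The kernel pair of `P.hom` is itself open over `X`, so subterminality forces its two projections
to coincide. -/
theorem isSubterminal_iff_mono [IsClopos O] {X : G} (P : O.Over ⊤ X) :
    IsSubterminal P ↔ Mono P.hom := by
  constructor
  · intro h
    have := IsClopos.hasPullback P.hom P.hom P.prop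
    refine ⟨fun {Z} a b hab => ?_⟩
    let K : O.Over ⊤ X := MorphismProperty.Over.mk ⊤ (pullback.fst P.hom P.hom ≫ P.hom)
      (O.comp_mem _ _ (O.pullback_fst _ _ P.prop) P.prop)
    have e := h (Z := K) (MorphismProperty.Over.homMk (pullback.fst P.hom P.hom))
      (MorphismProperty.Over.homMk (pullback.snd P.hom P.hom) pullback.condition.symm)
    have e : pullback.fst P.hom P.hom = pullback.snd P.hom P.hom :=
      congrArg (fun k : K ⟶ P => k.left) e
    rw [← pullback.lift_fst a b hab, e, pullback.lift_snd]
  · intro _ Z f g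
    ext
    rw [← cancel_mono P.hom, MorphismProperty.Over.w, MorphismProperty.Over.w]

theorem isEquivRel_of_isKernelPair {U V P : G} {d₀ d₁ : U ⟶ V} {p : V ⟶ P}
    (h : IsKernelPair p d₀ d₁) : IsEquivRel d₀ d₁ := by
  refine fun T => ⟨fun s t hs ht => h.hom_ext hs ht, ?_⟩
  have : (fun a b : T ⟶ V => ∃ t : T ⟶ U, t ≫ d₀ = a ∧ t ≫ d₁ = b) =
      fun a b => a ≫ p = b ≫ p := by
    ext a b
    constructor
    · rintro ⟨t, rfl, rfl⟩
      simp [h.w]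
    · intro e
      exact ⟨h.lift a b e, by simp, by simp⟩
  rw [this]
  exact ⟨fun _ => rfl, fun h => h.symm, fun h h' => h.trans h'⟩

theorem isLocallyCoequalizable_of_isCoequalizable [O.ContainsIdentities] {U X : G}
    {d₀ d₁ : U ⟶ X} (h : IsCoequalizable O d₀ d₁) : IsLocallyCoequalizable O d₀ d₁ := by
  refine ⟨.singleton (𝟙 X), fun Z a b h => by simpa using h (f := 𝟙 X) ⟨⟩, ?_⟩
  rintro _ _ ⟨⟩
  refine ⟨O.id_mem X, U, d₀, d₁, ⟨U, U, d₀, 𝟙 U, 𝟙 U, d₁, 𝟙 U, 𝟙 U, ?_, ?_, ?_, ?_, ?_⟩, h⟩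
  · exact .of_vert_isIso ⟨by simp⟩
  · exact .of_horiz_isIso ⟨by simp⟩
  · exact .of_vert_isIso ⟨by simp⟩
  · simp
  · simp

/-- In a glutos, an epimorphism of the topos of open arrows over `X` is an epimorphism. -/
theorem IsGlutos.epi_left [hO : IsGlutos O] {X : G} {V P : O.Over ⊤ X} (p : V ⟶ P) [Epi p] :
    Epi p.left := by
  have hp : O p.left := hO.of_postcomp p.left P.hom P.prop (by
    rw [MorphismProperty.Over.w]
    exact V.prop)
  have := IsClopos.hasPullback p.left p.left hp
  have hk := IsKernelPair.of_hasPullback p.left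
  obtain ⟨Q, q, hq, hqO, hqU, hqK⟩ := hO.exists_coequalizer _ _ (isEquivRel_of_isKernelPair hk)
    (O.pullback_fst _ _ hp) (O.pullback_snd _ _ hp)
    (isLocallyCoequalizable_of_isCoequalizable ⟨_, p.left, hp, hk.w⟩)
  have hc := hqU.isColimit
  have hqe : Epi q := ⟨fun a b h => Cofork.IsColimit.hom_ext hc h⟩
  let m : Q ⟶ P.left := Cofork.IsColimit.desc hc p.left hk.w
  have hm : q ≫ m = p.left := Cofork.IsColimit.π_desc' hc p.left hk.w
  have hmO : O m := hO.of_precomp q m hqe hqO (by rwa [hm])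
  let Q' : O.Over ⊤ X := MorphismProperty.Over.mk ⊤ (m ≫ P.hom) (O.comp_mem _ _ hmO P.prop)
  let q' : V ⟶ Q' := MorphismProperty.Over.homMk q (by
    change q ≫ m ≫ P.hom = V.hom
    rw [reassoc_of% hm, MorphismProperty.Over.w])
  let m' : Q' ⟶ P := MorphismProperty.Over.homMk m
  have hm' : q' ≫ m' = p := by
    ext
    exact hm
  -- The coequalizer `q'` identifies whatever `p` does, so it factors through `p`, and the factor
  -- `n` is a section of `m'`. Hence `p.left` is the epimorphism `q` followed by a split
  -- epimorphism.
  obtain ⟨n, hn⟩ := (hO.isTopos X).exists_desc p q' fun T s t hst => by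
    ext
    have h : s.left ≫ p.left = t.left ≫ p.left := congrArg (fun k : T ⟶ P => k.left) hst
    change s.left ≫ q = t.left ≫ q
    rw [← hk.lift_fst _ _ h, Category.assoc, hq, ← Category.assoc, hk.lift_snd]
  have hnm : n ≫ m' = 𝟙 P := by
    rw [← cancel_epi p, reassoc_of% hn, hm', Category.comp_id]
  have : IsSplitEpi m := ⟨⟨n.left, congrArg (fun k : P ⟶ P => k.left) hnm⟩⟩
  rw [← hm]
  exact epi_comp q m

/-- The open monomorphisms to an object of `O / X` generated by subterminals whose composites with
its structure arrow are monomorphisms form a covering. -/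
theorem IsGlutos.mem_monoPart_of_isSubterminalGenerated [hO : IsGlutos O] {X : G}
    (P : O.Over ⊤ X) (hP : IsSubterminalGenerated P) :
    ∃ S ∈ monoPart (openEpi O) P.left, ∀ ⦃U : G⦄ ⦃g : U ⟶ P.left⦄, S g →
      O (g ≫ P.hom) ∧ Mono (g ≫ P.hom) := by
  let S : Presieve P.left := fun U g => (O g ∧ Mono g) ∧ O (g ≫ P.hom) ∧ Mono (g ≫ P.hom)
  refine ⟨S, ⟨⟨fun U g hg => hg.1.1, ?_⟩, fun U g hg => hg.1.2⟩, fun U g hg => hg.2⟩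
  obtain ⟨ι, K, hK, hK'⟩ := (hO.isTopos X).exists_small_subterminals
  let Y (k : Σ i, (K i ⟶ P)) : G := (K k.1).left
  obtain ⟨c, hc, hcO⟩ := hO.exists_coproduct Y
  have hc := hc.isColimit
  let p : c.pt ⟶ P.left := Cofan.IsColimit.desc hc fun k => k.2.left
  have hp (k) : c.inj k ≫ p = k.2.left := Cofan.IsColimit.fac hc _ k
  have hpO : O (p ≫ P.hom) := hO.of_coproduct c hc _ fun k => by
    rw [reassoc_of% hp, MorphismProperty.Over.w]
    exact (K k.1).prop
  let V : O.Over ⊤ X := MorphismProperty.Over.mk ⊤ (p ≫ P.hom) hpO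
  let p' : V ⟶ P := MorphismProperty.Over.homMk p
  -- Every morphism to `P` from a subterminal factors through the coproduct, so generation makes
  -- `p'` epi in the topos; `IsGlutos.epi_left` then makes `p` epi in `G`.
  have : Epi p' := ⟨fun {Q} f g h => hP f g fun L hL s => by
    obtain ⟨i, ⟨e⟩⟩ := hK' L hL
    rw [← cancel_epi e.hom]
    ext
    let k : Σ i, (K i ⟶ P) := ⟨i, e.hom ≫ s⟩
    have h1 : p ≫ f.left = p ≫ g.left := congrArg (fun k : V ⟶ Q => k.left) h
    have h2 := congrArg (fun x => c.inj k ≫ x) h1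
    simp only [← Category.assoc, hp] at h2
    simpa [k] using h2⟩
  have : Epi p := IsGlutos.epi_left p'
  intro Z a b h
  rw [← cancel_epi p]
  refine Cofan.IsColimit.hom_ext hc _ _ fun k => ?_
  rw [reassoc_of% hp, reassoc_of% hp]
  have hw := MorphismProperty.Over.w k.2
  have h1 := (isSubterminal_iff_mono _).1 (hK k.1)
  have h2 : O (k.2.left ≫ P.hom) := by rw [hw]; exact (K k.1).prop
  have h3 : Mono (k.2.left ≫ P.hom) := by rw [hw]; exact h1
  exact h ⟨⟨hO.of_postcomp _ _ P.prop h2, mono_of_mono k.2.left P.hom⟩, h2, h3⟩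

/-- An arrow which is open on a covering by open monomorphisms is open. -/
theorem IsGlutos.of_cover [hO : IsGlutos O] {Y X : G} (f : Y ⟶ X) {S : Presieve Y}
    (hS : S ∈ monoPart (openEpi O) Y) (h : ∀ ⦃U : G⦄ ⦃g : U ⟶ Y⦄, S g → O (g ≫ f)) : O f := by
  obtain ⟨ι, K, -, hK'⟩ := (hO.isTopos Y).exists_small_subterminals
  have hgO {U : G} {g : U ⟶ Y} (hg : S g) : O g := hS.1.1 hg
  -- The cover may be large, but up to isomorphism its members form a small set of subterminals over
  -- `Y`. Their coproduct maps to `Y` by an open epimorphism, along which openness descends.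
  let κ : Type u := {i : ι // ∃ (U : G) (g : U ⟶ Y) (hg : S g),
    Nonempty (K i ≅ MorphismProperty.Over.mk ⊤ g (hgO hg))}
  obtain ⟨c, hc, hcO⟩ := hO.exists_coproduct fun k : κ => (K k.1).left
  have hc := hc.isColimit
  let p : c.pt ⟶ Y := Cofan.IsColimit.desc hc fun k => (K k.1).hom
  have hp (k : κ) : c.inj k ≫ p = (K k.1).hom := Cofan.IsColimit.fac hc _ k
  have hpO : O p := hO.of_coproduct c hc _ fun k => by
    rw [hp]
    exact (K k.1).prop
  have hpe : Epi p := ⟨fun {Z} a b hab => hS.1.2 a b fun U g hg => by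
    have : IsSubterminal (MorphismProperty.Over.mk ⊤ g (hgO hg)) :=
      (isSubterminal_iff_mono _).2 (hS.2 hg)
    obtain ⟨i, ⟨e⟩⟩ := hK' _ this
    let k : κ := ⟨i, U, g, hg, ⟨e⟩⟩
    let l : U ⟶ (K i).left := e.inv.left
    have h1 : l ≫ c.inj k ≫ p = g := by
      rw [hp]
      exact MorphismProperty.Over.w e.inv
    rw [← h1, Category.assoc, Category.assoc, hab, Category.assoc, Category.assoc]⟩
  refine hO.of_precomp p f hpe hpO (hO.of_coproduct c hc _ fun k => ?_)
  obtain ⟨i, U, g, hg, ⟨e⟩⟩ := k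
  rw [reassoc_of% hp]
  let l : (K i).left ⟶ U := e.hom.left
  have h1 : l ≫ g = (K i).hom := MorphismProperty.Over.w e.hom
  have h2 : IsIso l := ⟨e.inv.left, congrArg (fun k : K i ⟶ K i => k.left) e.hom_inv_id,
    congrArg (fun k : MorphismProperty.Over.mk ⊤ g (hgO hg) ⟶ _ => k.left) e.inv_hom_id⟩
  have h3 : O ((K i).hom ≫ f) := by
    rw [← h1, Category.assoc]
    exact O.comp_mem _ _ (O.of_isIso _) (h hg)
  exact h3

/-- The members of the cover are subterminals over `X` that map to `P`, and they are already jointly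
epi in `G`. -/
theorem isSubterminalGenerated_of_cover [IsClopos O] {X : G} (P : O.Over ⊤ X) {S : Presieve P.left}
    (hS : S ∈ monoPart (openEpi O) P.left)
    (h : ∀ ⦃U : G⦄ ⦃g : U ⟶ P.left⦄, S g → O (g ≫ P.hom) ∧ Mono (g ≫ P.hom)) :
    IsSubterminalGenerated P := by
  intro Q a b hab
  ext
  refine hS.1.2 _ _ fun U g hg => ?_
  let L : O.Over ⊤ X := MorphismProperty.Over.mk ⊤ (g ≫ P.hom) (h hg).1
  let s : L ⟶ P := MorphismProperty.Over.homMk g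
  exact congrArg (fun k : L ⟶ Q => k.left) (hab ((isSubterminal_iff_mono L).2 (h hg).2) s)

end OpenArrows

/-! ### Transport from the glutos to the nearly glutos -/

section Nearly

variable {C : Type w} [Category.{u} C]

/-- Clopen arrows are invariant under isomorphism of arrows. -/
theorem clopen.iso_comp_iso {τ : Precoverage C} [IsPresite τ] {U X U' X' : C} {f : U ⟶ X}
    (hf : clopen τ f) (i : U' ≅ U) (j : X ≅ X') : clopen τ (i.hom ≫ f ≫ j.hom) := by
  obtain ⟨S, hS, hf⟩ := hf
  -- Each arrow of `S` is listed once for every isomorphism onto its source, so that base change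
  -- along `j.inv`, with these sources as the pullbacks, contains the required composite itself.
  let ι := Σ (Y : C), {p : Σ Z : C, (Y ≅ Z) × (Z ⟶ X) // S p.2.2}
  have hS' : Presieve.ofArrows (fun k : ι => k.2.1.1) (fun k => k.2.1.2.2) ∈ τ X := by
    convert hS
    refine le_antisymm ?_ fun Z g hg => ?_
    · rintro _ _ ⟨k⟩
      exact k.2.2
    · exact Presieve.ofArrows.mk (f := fun k : ι => k.2.1.2.2) ⟨Z, ⟨Z, Iso.refl Z, g⟩, hg⟩
  have := Precoverage.mem_coverings_of_isPullback (J := τ) _ hS' j.inv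
    (P := fun k : ι => k.1) (fun k => k.2.1.2.1.hom ≫ k.2.1.2.2 ≫ j.hom)
    (fun k => k.2.1.2.1.hom) fun k => .of_vert_isIso ⟨by simp⟩
  exact ⟨_, this, Presieve.ofArrows.mk
    (f := fun k : ι => k.2.1.2.1.hom ≫ k.2.1.2.2 ≫ j.hom) ⟨U', ⟨U, i, f⟩, hf⟩⟩

theorem IsContinuous.map_locallyClopen {τ : Precoverage C} {G : Type w'} [Category.{v'} G]
    {σ : Precoverage G} {F : C ⥤ G} (hF : IsContinuous τ σ F) {Y X : C} {f : Y ⟶ X}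
    (hf : locallyClopen τ f) :
    locallyClopen σ (F.map f) := by
  obtain ⟨S, hS, h⟩ := hf
  refine ⟨_, hF.map_mem hS, ?_⟩
  rintro _ _ ⟨hg⟩
  rw [← Functor.map_comp]
  exact hF.map_clopen (h hg)

variable {τ : Precoverage C} [IsPresite τ] {G : Type w'} [Category.{u} G] {O : MorphismProperty G}
  (e : C ≌ G)

theorem clopen_inverse_map_comp_unitInv
    (he : IsContinuous (monoPart (openEpi O)) τ e.inverse) {X : C} {P : G}
    {f : P ⟶ e.functor.obj X} (hf : clopen (monoPart (openEpi O)) f) :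
    clopen τ (e.inverse.map f ≫ e.unitInv.app X) := by
  have := (he.map_clopen hf).iso_comp_iso (Iso.refl _) (e.unitIso.symm.app X)
  simpa using this

theorem map_inverse_map_comp_unitInv {X : C} {P : G} (f : P ⟶ e.functor.obj X) :
    e.functor.map (e.inverse.map f ≫ e.unitInv.app X) = e.counit.app P ≫ f := by
  simp

theorem IsGlutos.of_locallyClopen [hO : IsGlutos O] {Y X : G} {f : Y ⟶ X}
    (hf : locallyClopen (monoPart (openEpi O)) f) : O f := by
  obtain ⟨S, hS, h⟩ := hf
  exact IsGlutos.of_cover f hS fun U g hg => ((clopen_monoPart_iff _).1 (h hg)).1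

variable [hO : IsGlutos O] (he : IsContinuous τ (monoPart (openEpi O)) e.functor) (X : C)

/-- The comparison functor from locally clopen arrows to open arrows. -/
def toOpenOver : LocallyClopenOver τ X ⥤ O.Over ⊤ (e.functor.obj X) where
  obj P := MorphismProperty.Over.mk ⊤ (e.functor.map P.hom)
    (IsGlutos.of_locallyClopen (he.map_locallyClopen P.prop))
  map f := MorphismProperty.Over.homMk (e.functor.map f.left) (by
    have := MorphismProperty.Over.w f
    change e.functor.map f.left ≫ e.functor.map _ = e.functor.map _
    rw [← Functor.map_comp, this])
  map_id P := by
    ext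
    exact e.functor.map_id _
  map_comp f g := by
    ext
    exact e.functor.map_comp _ _

instance : (toOpenOver e he X).Faithful where
  map_injective {P Q f g} h := by
    ext
    exact e.functor.map_injective (congrArg (fun k : (toOpenOver e he X).obj P ⟶
      (toOpenOver e he X).obj Q => k.left) h)

instance : (toOpenOver e he X).Full where
  map_surjective {P Q} k := by
    let l : e.functor.obj P.left ⟶ e.functor.obj Q.left := k.left
    have hl : l ≫ e.functor.map Q.hom = e.functor.map P.hom := MorphismProperty.Over.w k
    refine ⟨MorphismProperty.Over.homMk (e.functor.preimage l) ?_, ?_⟩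
    · refine e.functor.map_injective ?_
      rw [Functor.map_comp, Functor.map_preimage]
      exact hl
    · ext
      exact e.functor.map_preimage _

instance : (incl τ X).Full where
  map_surjective {U V} k := by
    have h : U ≤ V := Subobject.le_of_comm k.left (MorphismProperty.Over.w k)
    refine ⟨homOfLE h, ?_⟩
    ext
    refine (cancel_mono V.1.arrow).1 ?_
    exact (Subobject.ofLE_arrow _).trans (MorphismProperty.Over.w k).symm

/-- Continuity of `e.functor` carries clopen data into the topos of open arrows; continuity of
`e.inverse` brings open monomorphisms and their coverings back, which gives the two essential
surjectivity conditions. -/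
theorem isSheafRepresentation_incl (he : IsContinuous τ (monoPart (openEpi O)) e.functor) (X : C)
    (he' : IsContinuous (monoPart (openEpi O)) τ e.inverse) :
    IsSheafRepresentation (incl τ X) := by
  refine isSheafRepresentation_of_isTopos (hO.isTopos (e.functor.obj X)) (incl τ X)
    (toOpenOver e he X) ?_ ?_ ?_ ?_
  · intro U
    rw [isSubterminal_iff_mono]
    exact inferInstanceAs (Mono (e.functor.map U.1.arrow))
  · intro P hP
    have hm := (isSubterminal_iff_mono _).1 hP
    have hf := clopen_inverse_map_comp_unitInv e he' ((clopen_monoPart_iff P.hom).2 ⟨P.prop, hm⟩)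
    let f : e.inverse.obj P.left ⟶ X := e.inverse.map P.hom ≫ e.unitInv.app X
    have : Mono f := mono_comp _ _
    have hU : clopen τ (Subobject.mk f).arrow := by
      have := hf.iso_comp_iso (Subobject.underlyingIso f) (Iso.refl X)
      have e : (Subobject.underlyingIso f).hom ≫ f ≫ 𝟙 X = (Subobject.mk f).arrow := by simp
      exact e ▸ this
    refine ⟨⟨Subobject.mk f, hU⟩, ⟨MorphismProperty.Over.isoMk
      (e.functor.mapIso (Subobject.underlyingIso f) ≪≫ e.counitIso.app P.left) ?_⟩⟩
    change (e.functor.map _ ≫ e.counit.app P.left) ≫ P.hom = e.functor.map _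
    rw [Category.assoc, ← map_inverse_map_comp_unitInv, ← Functor.map_comp]
    congr 1
    exact Subobject.underlyingIso_hom_comp_eq_mk f
  · intro P
    obtain ⟨S, hS, h⟩ := he.map_locallyClopen P.prop
    exact isSubterminalGenerated_of_cover ((toOpenOver e he X).obj P) hS
      fun U g hg => (clopen_monoPart_iff _).1 (h hg)
  · intro P hP
    obtain ⟨S, hS, h⟩ := IsGlutos.mem_monoPart_of_isSubterminalGenerated P hP
    have hf : locallyClopen τ (e.inverse.map P.hom ≫ e.unitInv.app X) := by
      refine ⟨_, he'.map_mem hS, ?_⟩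
      rintro _ _ ⟨hg⟩
      rw [← Category.assoc, ← Functor.map_comp]
      exact clopen_inverse_map_comp_unitInv e he' ((clopen_monoPart_iff _).2 (h hg))
    exact ⟨MorphismProperty.Over.mk ⊤ _ hf, ⟨MorphismProperty.Over.isoMk (e.counitIso.app P.left)
      (map_inverse_map_comp_unitInv e P.hom).symm⟩⟩

end Nearly

end Glutos

theorem mainTheorem8 {C : Type w} [Category.{u} C] (τ : Precoverage C) [Glutos.IsPresite τ]
    (hτ : Glutos.IsNearlyGlutos τ) (X : C) :
    Small.{u} (Glutos.ClopenSubobject τ X) ∧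
    Glutos.IsCompleteHeyting (Glutos.ClopenSubobject τ X) ∧
    Glutos.IsSGTopos.{max w (u + 1), max w u, u} (Glutos.Sh τ X) ∧
    ∃ (J : Glutos.Sh τ X ⥤ Glutos.LocallyClopenOver τ X)
      (β : sheafToPresheaf _ _ ≅ J ⋙ Glutos.sections τ X),
      J.IsEquivalence ∧
      ∀ F : Glutos.Sh τ X,
        (∀ i j : Glutos.Index F.obj, ∃ k, IsGLB {i, j} k) ∧
        Nonempty (IsColimit (Glutos.gluingCocone (β.hom.app F))) := by
  obtain ⟨-, P, _, σ, G, _, O, Y, e, -, -, hY, he, he'⟩ := hτ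
  have := hY.isGlutos
  exact (Glutos.isSheafRepresentation_incl e he X he').exists_equivalence
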